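/- Let $\mathscr C$ be a rigid C$^*$-tensor category with simple unit $\mathbb 1$ (i.e. $\mathrm{End}(\mathbb 1)=\mathbb C I_{\mathbb 1}\neq 0$), finite direct sums and subobjects, written as if it were strict. Let $\mathscr S\ni\mathbb 1$ be a set of representatives of the isomorphism classes of simple objects. For every $\alpha\in\mathscr S$ choose a conjugate object $\overline\alpha$ and a standard solution $\eta_\alpha\in \mathrm{Hom}(\mathbb 1,\overline\alpha\alpha)$, $\varepsilon_\alpha\in \mathrm{Hom}(\alpha\overline\alpha,\mathbb 1)$ of the conjugate equations $(\varepsilon_\alpha\otimes I_\alpha)(I_\alpha\otimes\eta_\alpha)=I_\alpha$, $(I_{\overline\alpha}\otimes\varepsilon_\alpha)(\eta_\alpha\otimes I_{\overline\alpha})=I_{\overline\alpha}$ (as $\alpha$ is simple, standard means $\eta_\alpha^*\eta_\alpha=\varepsilon_\alpha\varepsilon_\alpha^*$), and put $d_\alpha=\eta_\alpha^*\eta_\alpha\in\mathbb R$. Let $\Lambda=\mathscr S\sqcup\overline{\mathscr S}$ be the disjoint union of $\mathscr S$ and of the set of letters $\overline\alpha$, $\alpha\in\mathscr S$, with the involution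 $\alpha\leftrightarrow\overline\alpha$, and put $r_\alpha=\eta_\alpha$, $r_{\overline\alpha}=\varepsilon_\alpha^*$ for $\alpha\in\mathscr S$. Let $\lambda_\alpha>0$ ($\alpha\in\mathscr S$) be arbitrary and $\lambda_{\overline\alpha}=1/\lambda_\alpha$. Let $\mathfrak A(\mathbb 1)=\bigoplus_{\beta\in\mathscr S}\mathbb C I_\beta$ be the von Neumann algebra of bounded families $(a_\beta)_{\beta\in\mathscr S}$, with the weight $\tau(a)=\sum_\beta d_\beta a_\beta$, $a\ge 0$. Let $H(\mathbb 1)=\bigoplus_{\beta_1,\beta_2\in\mathscr S,\ \alpha\in\Lambda}\mathrm{Hom}(\beta_1,\beta_2\alpha)$ (algebraic direct sum), with $a\cdot\xi\cdot b=a_{\beta_2}b_{\beta_1}\xi$ for $\xi\in \mathrm{Hom}(\beta_1,\beta_2\alpha)$, and with the $\mathfrak A(\mathbb 1)$-valued inner product for which the summands are mutually orthogonal and $\langle\xi,\zeta\rangle_{\mathfrak A(\mathbb 1)}=\xi^*\zeta\in \mathrm{End}(\beta_1)=\mathbb C I_{\beta_1}$ for $\xi,\zeta\in \mathrm{Hom}(\beta_1,\beta_2\alpha)$.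 For $\xi\in \mathrm{Hom}(\beta_1,\beta_2\alpha)$ let $\overline\xi=(\xi^*\otimes I_{\overline\alpha})(I_{\beta_2}\otimes r_{\overline\alpha})\in \mathrm{Hom}(\beta_2,\beta_1\overline\alpha)$, and let $$S\xi=\sqrt{\lambda_\alpha}\,\overline\xi,\qquad U(z)\xi=\lambda_\alpha^{iz}\,\xi\quad(z\in\mathbb C),$$ where $S$ is extended additively and $U(z)$ linearly to $H(\mathbb 1)$. Then, with this $S$ and $U$, $H(\mathbb 1)$ is a Tomita $\mathfrak A(\mathbb 1)$-$\mathfrak A(\mathbb 1)$ bimodule. That is, writing $\mathfrak A=\mathfrak A(\mathbb 1)$ and $H=H(\mathbb 1)$: $\mathfrak A$ is a von Neumann algebra and $\tau$ is a normal semifinite faithful tracial weight on it; $H$ is a pre-Hilbert $\mathfrak A$-$\mathfrak A$ bimodule, i.e. $\langle\cdot,\cdot\rangle_{\mathfrak A}$ is sesquilinear and positive definite, $\langle\xi,b\cdot\zeta\cdot a\rangle_{\mathfrak A}=\langle b^*\cdot\xi,\zeta\rangle_{\mathfrak A}\,a$, and $\|a\cdot\xi\|_H\le\|a\|\,\|\xi\|_H$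 with $\|\xi\|_H=\|\langle\xi,\xi\rangle_{\mathfrak A}\|^{1/2}$; the left action is normal, i.e. each map $a\mapsto\langle\xi,a\cdot\xi\rangle_{\mathfrak A}$ is weak-operator continuous on the unit ball of $\mathfrak A$; and, with $\langle\xi,\zeta\rangle=\tau(\langle\xi,\zeta\rangle_{\mathfrak A})$, 1. $\tau(\langle\xi,\xi\rangle_{\mathfrak A})<\infty$ for all $\xi\in H$; 2. $S$ is conjugate linear, $S(a\cdot\xi\cdot b)=b^*\cdot S(\xi)\cdot a^*$ and $S^2=\mathrm{id}$; 3. $\{U(z)\}_{z\in\mathbb C}$ is a one-parameter group ($U(0)=\mathrm{id}$, $U(z+w)=U(z)U(w)$) of bimodule isomorphisms of $H$ such that for all $\xi,\zeta\in H$ and $z\in\mathbb C$: (a) $z\mapsto U(z)\zeta$ is continuous for $\|\cdot\|_H$ and $z\mapsto\langle\xi,U(z)\zeta\rangle$ is entire; (b) $S(U(z)\xi)=U(\overline z)S(\xi)$; (c) $\langle\xi,U(z)\zeta\rangle=\langle U(-\overline z)\xi,\zeta\rangle$; (d) $\langle S\xi,S\zeta\rangle=\langle\zeta,U(-i)\xi\rangle$.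 -/

import Mathlib

open CategoryTheory MonoidalCategory
open scoped ENNReal NNReal ComplexOrder DirectSum

universe v u w

noncomputable section

/-! ### Traces on von Neumann algebras, pre-Hilbert bimodules, Tomita bimodules -/

namespace TomitaBimodule

section Algebra

variable {A : Type u} [CStarAlgebra A] [PartialOrder A] [StarOrderedRing A]

/-- `D` is an increasing net of positive elements with supremum `a`. -/
def IncreasesTo (D : Set A) (a : A) : Prop :=
  D.Nonempty ∧ DirectedOn (· ≤ ·) D ∧ (∀ d ∈ D, 0 ≤ d) ∧ IsLUB D a

/-- A normal semifinite faithful tracial weight, given as a function into `[0, ∞]`;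
only its values on the positive cone of `A` matter. -/
structure IsNSFTrace (τ : A → ℝ≥0∞) : Prop where
  map_add : ∀ a b : A, 0 ≤ a → 0 ≤ b → τ (a + b) = τ a + τ b
  map_smul : ∀ (r : ℝ≥0) (a : A), 0 ≤ a → τ (((r : ℝ) : ℂ) • a) = r * τ a
  tracial : ∀ a : A, τ (star a * a) = τ (a * star a)
  faithful : ∀ a : A, 0 ≤ a → τ a = 0 → a = 0
  normal : ∀ (D : Set A) (a : A), IncreasesTo D a → τ a = ⨆ d ∈ D, τ d
  semifinite : ∀ a : A, 0 ≤ a → a ≠ 0 → ∃ b : A, 0 ≤ b ∧ b ≤ a ∧ b ≠ 0 ∧ τ b < ∞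

/-- `a = p - q + i (r - s)` with `p, q, r, s` positive and of finite weight. -/
def IsFiniteDecomposition (τ : A → ℝ≥0∞) (a : A) (x : A × A × A × A) : Prop :=
  (0 ≤ x.1 ∧ 0 ≤ x.2.1 ∧ 0 ≤ x.2.2.1 ∧ 0 ≤ x.2.2.2) ∧
  (τ x.1 < ∞ ∧ τ x.2.1 < ∞ ∧ τ x.2.2.1 < ∞ ∧ τ x.2.2.2 < ∞) ∧
  a = (x.1 - x.2.1) + Complex.I • (x.2.2.1 - x.2.2.2)

open Classical in
/-- The linear extension of a weight to the linear span of the positive elements of finite weight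
(and `0` outside of that span). It does not depend on the decomposition that is used:
see `extend_eq`. -/
def extend (τ : A → ℝ≥0∞) (a : A) : ℂ :=
  if h : ∃ x : A × A × A × A, IsFiniteDecomposition τ a x then
    (((τ h.choose.1).toReal - (τ h.choose.2.1).toReal : ℝ) : ℂ) +
      Complex.I * (((τ h.choose.2.2.1).toReal - (τ h.choose.2.2.2).toReal : ℝ) : ℂ)
  else 0

theorem extend_eq {τ : A → ℝ≥0∞} (hτ : IsNSFTrace τ) {a : A} {x : A × A × A × A}
    (hx : IsFiniteDecomposition τ a x) :
    extend τ a = (((τ x.1).toReal - (τ x.2.1).toReal : ℝ) : ℂ) +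
      Complex.I * (((τ x.2.2.1).toReal - (τ x.2.2.2).toReal : ℝ) : ℂ) := by
  have key : ∀ p q p' q' : A, 0 ≤ p → 0 ≤ q → 0 ≤ p' → 0 ≤ q' → τ p < ∞ → τ q < ∞ → τ p' < ∞ →
      τ q' < ∞ → p - q = p' - q' → (τ p).toReal - (τ q).toReal = (τ p').toReal - (τ q').toReal := by
    intro p q p' q' hp hq hp' hq' fp fq fp' fq' h
    have h1 : p + q' = p' + q := by
      rw [sub_eq_sub_iff_add_eq_add] at h
      exact h
    have h2 := congrArg τ h1
    rw [hτ.map_add _ _ hp hq', hτ.map_add _ _ hp' hq] at h2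
    have h3 := congrArg ENNReal.toReal h2
    rw [ENNReal.toReal_add fp.ne fq'.ne, ENNReal.toReal_add fp'.ne fq.ne] at h3
    linarith
  have h : ∃ x : A × A × A × A, IsFiniteDecomposition τ a x := ⟨x, hx⟩
  obtain ⟨⟨a1, a2, a3, a4⟩, ⟨b1, b2, b3, b4⟩, c⟩ := hx
  obtain ⟨⟨a1', a2', a3', a4'⟩, ⟨b1', b2', b3', b4'⟩, c'⟩ := h.choose_spec
  have sa : ∀ p q : A, 0 ≤ p → 0 ≤ q → star (p - q) = p - q := fun p q hp hq => by
    rw [star_sub, (IsSelfAdjoint.of_nonneg hp).star_eq, (IsSelfAdjoint.of_nonneg hq).star_eq]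
  have e := c.symm.trans c'
  have e' := congrArg star e
  simp only [star_add, star_smul, sa _ _ a1 a2, sa _ _ a3 a4, sa _ _ a1' a2', sa _ _ a3' a4',
    Complex.star_def, Complex.conj_I, neg_smul] at e'
  have r1 : x.1 - x.2.1 = h.choose.1 - h.choose.2.1 := by
    have : (2 : ℂ) • (x.1 - x.2.1) = (2 : ℂ) • (h.choose.1 - h.choose.2.1) := by
      rw [two_smul, two_smul]
      have := congrArg₂ (· + ·) e e'
      convert this using 1 <;> abel
    exact smul_right_injective A (two_ne_zero : (2 : ℂ) ≠ 0) this
  have r2 : x.2.2.1 - x.2.2.2 = h.choose.2.2.1 - h.choose.2.2.2 := by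
    rw [r1] at e
    exact smul_right_injective A Complex.I_ne_zero (add_left_cancel e)
  rw [extend, dif_pos h, key _ _ _ _ a1 a2 a1' a2' b1 b2 b1' b2' r1,
    key _ _ _ _ a3 a4 a3' a4' b3 b4 b3' b4' r2]

/-- A normal positive linear functional. -/
def IsNormalFunctional (φ : A →ₗ[ℂ] ℂ) : Prop :=
  (∀ a : A, 0 ≤ a → 0 ≤ φ a) ∧
  ∀ (D : Set A) (a : A), IncreasesTo D a → IsLUB ((fun d => (φ d).re) '' D) (φ a).re

variable (A) in
/-- The ultraweak topology of a von Neumann algebra, i.e. the one generated by the normal positive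
functionals. On bounded sets it is the weak-operator topology of any faithful normal
representation. -/
abbrev ultraweak : TopologicalSpace A :=
  ⨅ φ : {φ : A →ₗ[ℂ] ℂ // IsNormalFunctional φ}, TopologicalSpace.induced φ.1 inferInstance

end Algebra

section Bimodule

variable {A : Type u} [CStarAlgebra A] [PartialOrder A] [StarOrderedRing A]
variable {H : Type w} [AddCommGroup H] [Module ℂ H] [Module A H] [Module Aᵐᵒᵖ H]

/-- The norm `‖ξ‖_H = ‖⟨ξ, ξ⟩_A‖ ^ (1/2)`. -/
def moduleNorm (ip : H → H → A) (ξ : H) : ℝ := Real.sqrt ‖ip ξ ξ‖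

/-- A pre-Hilbert `A`-`A` bimodule. The left action is `a • ξ`, the right action `ξ · a` is
`MulOpposite.op a • ξ`, and `ip` is the `A`-valued inner product. -/
structure IsPreHilbertBimodule (ip : H → H → A) : Prop where
  left_scalar : ∀ (c : ℂ) (ξ : H), (algebraMap ℂ A c) • ξ = c • ξ
  right_scalar : ∀ (c : ℂ) (ξ : H), MulOpposite.op (algebraMap ℂ A c) • ξ = c • ξ
  left_right : ∀ (a b : A) (ξ : H), a • (MulOpposite.op b • ξ) = MulOpposite.op b • (a • ξ)
  add_left : ∀ ξ₁ ξ₂ ζ : H, ip (ξ₁ + ξ₂) ζ = ip ξ₁ ζ + ip ξ₂ ζ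
  add_right : ∀ ξ ζ₁ ζ₂ : H, ip ξ (ζ₁ + ζ₂) = ip ξ ζ₁ + ip ξ ζ₂
  smul_left : ∀ (c : ℂ) (ξ ζ : H), ip (c • ξ) ζ = star c • ip ξ ζ
  smul_right : ∀ (c : ℂ) (ξ ζ : H), ip ξ (c • ζ) = c • ip ξ ζ
  ip_action : ∀ (a b : A) (ξ ζ : H),
    ip ξ (b • (MulOpposite.op a • ζ)) = ip (star b • ξ) ζ * a
  ip_nonneg : ∀ ξ : H, 0 ≤ ip ξ ξ
  ip_definite : ∀ ξ : H, ip ξ ξ = 0 → ξ = 0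
  norm_left_action : ∀ (a : A) (ξ : H), moduleNorm ip (a • ξ) ≤ ‖a‖ * moduleNorm ip ξ

/-- The left action is normal: every map `a ↦ ⟨ξ, a · ξ⟩_A` is weak-operator continuous on the
unit ball. -/
def HasNormalLeftAction (ip : H → H → A) : Prop :=
  ∀ ξ : H, @ContinuousOn A A (ultraweak A) (ultraweak A) (fun a => ip ξ (a • ξ))
    (Metric.closedBall 0 1)

/-- The scalar inner product `⟨ξ, ζ⟩ = τ (⟨ξ, ζ⟩_A)`. -/
def scalarInner (τ : A → ℝ≥0∞) (ip : H → H → A) (ξ ζ : H) : ℂ := extend τ (ip ξ ζ)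

/-- `H`, with `A`-valued inner product `ip`, involution `S` and complex one-parameter group `U`, is
a Tomita `A`-`A` bimodule, where `A` is a semifinite von Neumann algebra and `τ` is a normal
semifinite faithful tracial weight on it. -/
structure IsTomitaBimodule (τ : A → ℝ≥0∞) (ip : H → H → A) (S : H → H) (U : ℂ → H → H) : Prop where
  vonNeumann : WStarAlgebra A
  trace : IsNSFTrace τ
  preHilbert : IsPreHilbertBimodule ip
  normal : HasNormalLeftAction ip
  finite : ∀ ξ : H, τ (ip ξ ξ) < ∞
  S_add : ∀ ξ ζ : H, S (ξ + ζ) = S ξ + S ζ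
  S_smul : ∀ (c : ℂ) (ξ : H), S (c • ξ) = star c • S ξ
  S_action : ∀ (a b : A) (ξ : H),
    S (a • (MulOpposite.op b • ξ)) = star b • (MulOpposite.op (star a) • S ξ)
  S_S : ∀ ξ : H, S (S ξ) = ξ
  U_add : ∀ (z : ℂ) (ξ ζ : H), U z (ξ + ζ) = U z ξ + U z ζ
  U_smul : ∀ (z c : ℂ) (ξ : H), U z (c • ξ) = c • U z ξ
  U_action : ∀ (z : ℂ) (a b : A) (ξ : H),
    U z (a • (MulOpposite.op b • ξ)) = a • (MulOpposite.op b • U z ξ)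
  U_bijective : ∀ z : ℂ, Function.Bijective (U z)
  U_zero : ∀ ξ : H, U 0 ξ = ξ
  U_group : ∀ (z w : ℂ) (ξ : H), U (z + w) ξ = U z (U w ξ)
  U_continuous : ∀ (ζ : H) (z₀ : ℂ),
    Filter.Tendsto (fun z => moduleNorm ip (U z ζ - U z₀ ζ)) (nhds z₀) (nhds 0)
  U_entire : ∀ ξ ζ : H, Differentiable ℂ (fun z => scalarInner τ ip ξ (U z ζ))
  S_U : ∀ (z : ℂ) (ξ : H), S (U z ξ) = U (star z) (S ξ)
  U_adjoint : ∀ (z : ℂ) (ξ ζ : H),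
    scalarInner τ ip ξ (U z ζ) = scalarInner τ ip (U (-star z) ξ) ζ
  S_inner : ∀ ξ ζ : H,
    scalarInner τ ip (S ξ) (S ζ) = scalarInner τ ip ζ (U (-Complex.I) ξ)

end Bimodule

end TomitaBimodule

/-! ### Rigid C⋆-tensor categories -/

/-- A C⋆-category: a `ℂ`-linear category with an antilinear involution `dag` that reverses arrows
and with complete norms on the spaces of arrows satisfying the C⋆-identity and such that `f* f` is
a positive element of the C⋆-algebra `End X` for every arrow `f` out of `X`. -/
class CStarCategory (C : Type u) [Category.{v} C] [Preadditive C] [Linear ℂ C] where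
  dag : ∀ {X Y : C}, (X ⟶ Y) → (Y ⟶ X)
  dag_dag : ∀ {X Y : C} (f : X ⟶ Y), dag (dag f) = f
  dag_comp : ∀ {X Y Z : C} (f : X ⟶ Y) (g : Y ⟶ Z), dag (f ≫ g) = dag g ≫ dag f
  dag_add : ∀ {X Y : C} (f g : X ⟶ Y), dag (f + g) = dag f + dag g
  dag_smul : ∀ {X Y : C} (c : ℂ) (f : X ⟶ Y), dag (c • f) = star c • dag f
  homNorm : ∀ X Y : C, Norm (X ⟶ Y)
  norm_core : ∀ X Y : C, NormedSpace.Core ℂ (X ⟶ Y)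
  norm_complete : ∀ {X Y : C} (x : ℕ → (X ⟶ Y)),
    (∀ ε > (0 : ℝ), ∃ N, ∀ m ≥ N, ∀ n ≥ N, ‖x m - x n‖ < ε) →
      ∃ f : X ⟶ Y, ∀ ε > (0 : ℝ), ∃ N, ∀ n ≥ N, ‖x n - f‖ < ε
  norm_comp_le : ∀ {X Y Z : C} (f : X ⟶ Y) (g : Y ⟶ Z), ‖f ≫ g‖ ≤ ‖f‖ * ‖g‖
  norm_comp_dag : ∀ {X Y : C} (f : X ⟶ Y), ‖f ≫ dag f‖ = ‖f‖ ^ 2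
  comp_dag_pos : ∀ {X Y : C} (f : X ⟶ Y), ∃ g : X ⟶ X, f ≫ dag f = g ≫ dag g

open CStarCategory (dag)

/-- A (not necessarily strict) rigid C⋆-tensor category with finite direct sums and subobjects.
`v ≫ dag v = 𝟙` says that `v` is an isometry. -/
class RigidCStarTensorCategory (C : Type u) [Category.{v} C] [Preadditive C] [Linear ℂ C]
    [MonoidalCategory C] [MonoidalPreadditive C] [MonoidalLinear ℂ C] extends CStarCategory C where
  dag_tensor : ∀ {X₁ Y₁ X₂ Y₂ : C} (f : X₁ ⟶ Y₁) (g : X₂ ⟶ Y₂), dag (f ⊗ₘ g) = dag f ⊗ₘ dag g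
  dag_associator : ∀ X Y Z : C, dag (α_ X Y Z).hom = (α_ X Y Z).inv
  dag_leftUnitor : ∀ X : C, dag (λ_ X).hom = (λ_ X).inv
  dag_rightUnitor : ∀ X : C, dag (ρ_ X).hom = (ρ_ X).inv
  directSum : ∀ X Y : C, ∃ (Z : C) (i : X ⟶ Z) (j : Y ⟶ Z),
    i ≫ dag i = 𝟙 X ∧ j ≫ dag j = 𝟙 Y ∧ dag i ≫ i + dag j ≫ j = 𝟙 Z
  subobject : ∀ {X : C} (p : X ⟶ X), p ≠ 0 → p ≫ p = p → dag p = p →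
    ∃ (Y : C) (i : Y ⟶ X), i ≫ dag i = 𝟙 Y ∧ dag i ≫ i = p
  conjugates : ∀ X : C, ∃ Xbar : C, Nonempty (ExactPairing Xbar X)

namespace TomitaFromCategory

section Simple

variable {C : Type u} [Category.{v} C] [Preadditive C] [Linear ℂ C]

/-- Simple (irreducible) objects: `End X = ℂ 1_X ≠ 0`. -/
def IsSimpleObj (X : C) : Prop := 𝟙 X ≠ 0 ∧ ∀ f : X ⟶ X, ∃ c : ℂ, f = c • 𝟙 X

open Classical in
/-- The scalar `c` with `f = c 1_X`, for an endomorphism `f` of a simple object `X`. -/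
def coeff {X : C} (f : X ⟶ X) : ℂ := if h : ∃ c : ℂ, f = c • 𝟙 X then h.choose else 0

end Simple

variable {C : Type u} [Category.{v} C] [Preadditive C] [Linear ℂ C]
  [MonoidalCategory C] [MonoidalPreadditive C] [MonoidalLinear ℂ C]

variable (C) in
/-- A representative set of the simple objects, containing the tensor unit. -/
structure Representatives where
  carrier : Set C
  unit_mem : 𝟙_ C ∈ carrier
  simple : ∀ X ∈ carrier, IsSimpleObj X
  existsUnique : ∀ X : C, IsSimpleObj X → ∃! Y : C, Y ∈ carrier ∧ Nonempty (X ≅ Y)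

/-- The index type of the representative set. -/
abbrev Representatives.Idx (R : Representatives C) : Type u := {X : C // X ∈ R.carrier}

variable [RigidCStarTensorCategory C]

/-- A choice, for every representative simple object `a`, of a conjugate object and of a standard
solution `η : 𝟙 ⟶ ā ⊗ a`, `ε : a ⊗ ā ⟶ 𝟙` of the conjugate equations. Since `a` is simple, a
solution is standard if and only if it is normalized, i.e. `η* η = ε ε*`. -/
structure StandardConjugates (R : Representatives C) where
  conj : R.Idx → C
  pairing : ∀ a : R.Idx, ExactPairing (conj a) a.1
  normalized : ∀ a : R.Idx,
    (pairing a).coevaluation' ≫ dag (pairing a).coevaluation' =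
      dag (pairing a).evaluation' ≫ (pairing a).evaluation'

variable {R : Representatives C}

namespace StandardConjugates

variable (D : StandardConjugates R)

/-- `η_a : 𝟙 ⟶ ā ⊗ a`. -/
def eta (a : R.Idx) : 𝟙_ C ⟶ D.conj a ⊗ a.1 := (D.pairing a).coevaluation'

/-- `ε_a : a ⊗ ā ⟶ 𝟙`. -/
def eps (a : R.Idx) : a.1 ⊗ D.conj a ⟶ 𝟙_ C := (D.pairing a).evaluation'

/-- The dimension `d_a = η_a* η_a`. -/
def dim (a : R.Idx) : ℝ := (coeff (D.eta a ≫ dag (D.eta a))).re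

end StandardConjugates

/-- The set of letters: the disjoint union of the representatives (`Sum.inl a` is the letter `a`)
and of their conjugates (`Sum.inr a` is the letter `ā`). -/
abbrev Letter (R : Representatives C) : Type u := R.Idx ⊕ R.Idx

/-- The involution `α ↦ ᾱ` of the set of letters. -/
abbrev Letter.bar (l : Letter R) : Letter R := Sum.swap l

/-- The scalars `λ_α`, for all letters `α`, from their values on the representatives:
`λ_ā = 1 / λ_a`. -/
def letterScalar (lam : R.Idx → ℝ) : Letter R → ℝ
  | Sum.inl a => lam a
  | Sum.inr a => 1 / lam a

namespace StandardConjugates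

variable (D : StandardConjugates R)

/-- The object of the category underlying a letter. -/
def obj : Letter R → C
  | Sum.inl a => a.1
  | Sum.inr a => D.conj a

/-- The arrow `r_ᾱ : 𝟙 ⟶ α ⊗ ᾱ`, that is `ε_a*` if `α = a` and `η_a` if `α = ā`. -/
def rBar : ∀ l : Letter R, 𝟙_ C ⟶ D.obj l ⊗ D.obj (Letter.bar l)
  | Sum.inl a => dag (D.eps a)
  | Sum.inr a => D.eta a

end StandardConjugates

/-- The von Neumann algebra `𝔄(𝟙) = ⊕_β ℂ`, the bounded families of complex numbers. -/
abbrev Alg (R : Representatives C) : Type u := lp (fun _ : R.Idx => ℂ) ∞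

instance : PartialOrder (Alg R) := CStarAlgebra.spectralOrder _

instance : StarOrderedRing (Alg R) := CStarAlgebra.spectralOrderedRing _

/-- The trace on `𝔄(𝟙)` with `τ(1_β) = d_β`. -/
def StandardConjugates.tau (D : StandardConjugates R) (a : Alg R) : ℝ≥0∞ :=
  ∑' β : R.Idx, ENNReal.ofReal (D.dim β * (a β).re)

/-- Triples `(β₁, β₂, α)`. -/
abbrev Triple (R : Representatives C) : Type u := R.Idx × R.Idx × Letter R

/-- `(β₁, β₂, α) ↦ (β₂, β₁, ᾱ)`. -/
abbrev Triple.bar (t : Triple R) : Triple R := (t.2.1, t.1, Letter.bar t.2.2)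

namespace StandardConjugates

variable (D : StandardConjugates R)

/-- The space `Hom(β₁, β₂ α)`. -/
def HomSpace (t : Triple R) : Type v := t.1.1 ⟶ t.2.1.1 ⊗ D.obj t.2.2

/-- An element of `Hom(β₁, β₂ α)` as an arrow. -/
def toHom {t : Triple R} (ξ : D.HomSpace t) : t.1.1 ⟶ t.2.1.1 ⊗ D.obj t.2.2 := ξ

instance (t : Triple R) : AddCommGroup (D.HomSpace t) :=
  inferInstanceAs (AddCommGroup (t.1.1 ⟶ t.2.1.1 ⊗ D.obj t.2.2))

instance (t : Triple R) : Module ℂ (D.HomSpace t) :=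
  inferInstanceAs (Module ℂ (t.1.1 ⟶ t.2.1.1 ⊗ D.obj t.2.2))

/-- The left action: `a · ξ = a(β₂) ξ` on `Hom(β₁, β₂ α)`. -/
instance (t : Triple R) : Module (Alg R) (D.HomSpace t) where
  smul a ξ := a t.2.1 • ξ
  one_smul ξ := one_smul ℂ ξ
  mul_smul a b ξ := mul_smul (a t.2.1) (b t.2.1) ξ
  smul_zero a := smul_zero (a t.2.1)
  smul_add a := smul_add (a t.2.1)
  add_smul a b := add_smul (a t.2.1) (b t.2.1)
  zero_smul := zero_smul ℂ

/-- The right action: `ξ · a = a(β₁) ξ` on `Hom(β₁, β₂ α)`. -/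
instance (t : Triple R) : Module (Alg R)ᵐᵒᵖ (D.HomSpace t) where
  smul a ξ := a.unop t.1 • ξ
  one_smul ξ := one_smul ℂ ξ
  mul_smul a b ξ := (congrArg (· • ξ) (mul_comm (b.unop t.1) (a.unop t.1))).trans
    (mul_smul (a.unop t.1) (b.unop t.1) ξ)
  smul_zero a := smul_zero (a.unop t.1)
  smul_add a := smul_add (a.unop t.1)
  add_smul a b := add_smul (a.unop t.1) (b.unop t.1)
  zero_smul := zero_smul ℂ

/-- The bimodule `H(𝟙)`, the algebraic direct sum of the spaces `Hom(β₁, β₂ α)`. -/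
abbrev Hbim : Type (max u v) := ⨁ t : Triple R, D.HomSpace t

open Classical in
/-- The `𝔄(𝟙)`-valued inner product: the spaces `Hom(β₁, β₂ α)` are mutually orthogonal, and
`⟨ξ, ζ⟩ = ξ* ζ ∈ End β₁ = ℂ` for `ξ, ζ ∈ Hom(β₁, β₂ α)`. -/
def ip (ξ ζ : D.Hbim) : Alg R :=
  ∑ t ∈ DFinsupp.support ξ,
    lp.single ∞ t.1 (coeff (D.toHom (ζ t) ≫ dag (D.toHom (ξ t))))

/-- The conjugation `ξ ↦ ξ̄ = (ξ* ⊗ 1_ᾱ) ∘ (1_β₂ ⊗ r_ᾱ)` from `Hom(β₁, β₂ α)` to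
`Hom(β₂, β₁ ᾱ)`, with the coherence isomorphisms written out. -/
def homConj (t : Triple R) (ξ : t.1.1 ⟶ t.2.1.1 ⊗ D.obj t.2.2) :
    t.2.1.1 ⟶ t.1.1 ⊗ D.obj (Letter.bar t.2.2) :=
  (ρ_ t.2.1.1).inv ≫ t.2.1.1 ◁ D.rBar t.2.2 ≫
    (α_ t.2.1.1 (D.obj t.2.2) (D.obj (Letter.bar t.2.2))).inv ≫
      dag ξ ▷ D.obj (Letter.bar t.2.2)

/-- The conjugation `ξ ↦ ξ̄` as an additive map. -/
def homConjHom (t : Triple R) : D.HomSpace t →+ D.HomSpace (Triple.bar t) :=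
  AddMonoidHom.mk' (D.homConj t) (fun ξ ζ => by
    simp only [homConj]
    erw [CStarCategory.dag_add, MonoidalPreadditive.add_whiskerRight, Preadditive.comp_add,
      Preadditive.comp_add, Preadditive.comp_add]
    rfl)

open Classical in
/-- The involution: `S ξ = √λ_α ξ̄` for `ξ ∈ Hom(β₁, β₂ α)`. -/
def invol (lam : R.Idx → ℝ) : D.Hbim →+ D.Hbim :=
  DirectSum.toAddMonoid fun t =>
    (DirectSum.of D.HomSpace (Triple.bar t)).comp
      ((DistribSMul.toAddMonoidHom _ ((Real.sqrt (letterScalar lam t.2.2) : ℝ) : ℂ)).comp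
        (D.homConjHom t))

/-- The one-parameter group: `U(z) ξ = λ_α ^ (i z) ξ` for `ξ ∈ Hom(β₁, β₂ α)`. -/
def oneParam (lam : R.Idx → ℝ) (z : ℂ) : D.Hbim →ₗ[ℂ] D.Hbim :=
  DirectSum.lmap fun t =>
    ((letterScalar lam t.2.2 : ℂ) ^ (Complex.I * z)) • LinearMap.id

end StandardConjugates

end TomitaFromCategory

end

noncomputable section

open CStarCategory

/-! ### The involution of a C⋆-tensor category -/

namespace CStarCategory

variable {C : Type u} [Category.{v} C] [Preadditive C] [Linear ℂ C] [CStarCategory C]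

attribute [simp] dag_dag dag_comp dag_add dag_smul

/-! Vectors of H(𝟙) have finite support, and on each summand Hom(β₁, β₂α) the operations are scalars
or the conjugation ξ ↦ ξ̄, so every axiom reduces to single summands. Most are then elementary: U(z)
multiplies by λ_α^{iz}, S² = id is Frobenius reciprocity together with λ_ᾱ = 1/λ_α, and a ↦ ⟨ξ, aξ⟩
involves only finitely many coordinates of a. On the analytic side, ℓ^∞ is the dual of ℓ¹, and its
order and bounded suprema are coordinatewise, so τ is a weighted sum with positive weights.

The categorical point is axiom (d). Both sides carry the factor λ_α, and what remains is d_{β₂}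
ξ̄*ζ̄ = d_{β₁} ζ*ξ (`dim_mul_coeff_homConj`). Since ξ̄*ζ̄ is the partial trace of ξζ* over α, the
left side is the trace of ξζ* on β₂α, and the claim is the trace property Tr(ξζ*) = d_{β₁} ζ*ξ.

The trace property follows from sphericity. Left and right traces agree for normalized pairings of
simple objects, and sphericity passes to tensor products (`IsSpherical.tensor`). For b simple and X
with a spherical pairing, comparing the mates of ξ* for the given pairings with those for the
adjoint pairings yields an operator T on Hom(b, X) with Tr(ξζ*) = d_b ζ*Tξ. Equality of the two
traces forces T² = 1 and positivity of the trace forces T ≥ 0, hence T = 1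
(`IsSpherical.leftTrace_dag_comp_eq`). -/

@[simp]
theorem dag_id (X : C) : dag (𝟙 X) = 𝟙 X := by
  have h := dag_comp (dag (𝟙 X)) (𝟙 X)
  rwa [Category.comp_id, dag_dag, Category.comp_id, eq_comm] at h

theorem eq_zero_of_comp_dag_eq_zero {X Y : C} {f : X ⟶ Y} (h : f ≫ dag f = 0) : f = 0 := by
  let := homNorm X Y
  let := homNorm X X
  have h1 := norm_comp_dag f
  rw [h, ((norm_core X X).norm_eq_zero_iff 0).2 rfl] at h1
  exact ((norm_core X Y).norm_eq_zero_iff f).1 (by simpa using h1.symm)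

end CStarCategory

namespace TomitaFromCategory

/-! ### Endomorphisms of simple objects -/

section Simple

variable {C : Type u} [Category.{v} C] [Preadditive C] [Linear ℂ C]

theorem IsSimpleObj.eq_coeff_smul {X : C} (hX : IsSimpleObj X) (f : X ⟶ X) :
    f = coeff f • 𝟙 X := by
  have h := hX.2 f
  rw [coeff, dif_pos h]
  exact h.choose_spec

theorem IsSimpleObj.smul_id_injective {X : C} (hX : IsSimpleObj X) {a b : ℂ}
    (h : a • 𝟙 X = b • 𝟙 X) : a = b := smul_left_injective ℂ hX.1 h

theorem IsSimpleObj.coeff_smul_id {X : C} (hX : IsSimpleObj X) (c : ℂ) :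
    coeff (c • 𝟙 X) = c :=
  (hX.smul_id_injective (hX.eq_coeff_smul (c • 𝟙 X))).symm

theorem IsSimpleObj.coeff_eq {X : C} (hX : IsSimpleObj X) {f : X ⟶ X} {c : ℂ}
    (h : f = c • 𝟙 X) : coeff f = c := by rw [h, hX.coeff_smul_id]

theorem IsSimpleObj.coeff_add {X : C} (hX : IsSimpleObj X) (f g : X ⟶ X) :
    coeff (f + g) = coeff f + coeff g :=
  hX.coeff_eq (by rw [add_smul, ← hX.eq_coeff_smul, ← hX.eq_coeff_smul])

theorem IsSimpleObj.coeff_smul {X : C} (hX : IsSimpleObj X) (c : ℂ) (f : X ⟶ X) :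
    coeff (c • f) = c * coeff f :=
  hX.coeff_eq (by rw [mul_smul, ← hX.eq_coeff_smul])

variable [CStarCategory C]

theorem IsSimpleObj.coeff_dag {X : C} (hX : IsSimpleObj X) (f : X ⟶ X) :
    coeff (dag f) = star (coeff f) :=
  hX.coeff_eq (by conv_lhs => rw [hX.eq_coeff_smul f, dag_smul, dag_id])

/-- The positivity axiom replaces f by an endomorphism of X, which is a scalar c, so the coefficient
is |c|². -/
theorem IsSimpleObj.coeff_comp_dag_nonneg {X Y : C} (hX : IsSimpleObj X) (f : X ⟶ Y) :
    0 ≤ coeff (f ≫ dag f) := by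
  obtain ⟨g, hg⟩ := comp_dag_pos f
  rw [hg, hX.eq_coeff_smul g, dag_smul, dag_id, Linear.smul_comp, Category.id_comp, smul_smul,
    hX.coeff_smul_id]
  exact mul_star_self_nonneg _

theorem IsSimpleObj.eq_zero_of_coeff {X Y : C} (hX : IsSimpleObj X) {f : X ⟶ Y}
    (h : coeff (f ≫ dag f) = 0) : f = 0 :=
  eq_zero_of_comp_dag_eq_zero (by rw [hX.eq_coeff_smul (f ≫ dag f), h, zero_smul])

end Simple

end TomitaFromCategory

/-! ### Mates and traces with respect to exact pairings -/

section Mates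

open ExactPairing TomitaFromCategory

variable {C : Type u} [Category.{v} C] [MonoidalCategory C]
variable {X X' Y Y' : C}

/-- The mate `Y' ⟶ X'` of `f : X ⟶ Y` for left duals `X'`, `Y'` of `X`, `Y`. -/
def leftMate [ExactPairing X' X] [ExactPairing Y' Y] (f : X ⟶ Y) : Y' ⟶ X' :=
  @leftAdjointMate C _ _ X Y ⟨X'⟩ ⟨Y'⟩ f

/-- The mate `Y' ⟶ X'` of `f : X ⟶ Y` for right duals `X'`, `Y'` of `X`, `Y`. -/
def rightMate [ExactPairing X X'] [ExactPairing Y Y'] (f : X ⟶ Y) : Y' ⟶ X' :=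
  @rightAdjointMate C _ _ X Y ⟨X'⟩ ⟨Y'⟩ f

theorem coevaluation_comp_leftMate [ExactPairing X' X] [ExactPairing Y' Y] (f : X ⟶ Y) :
    η_ Y' Y ≫ leftMate f ▷ Y = η_ X' X ≫ X' ◁ f :=
  @coevaluation_comp_leftAdjointMate C _ _ X Y ⟨X'⟩ ⟨Y'⟩ f

theorem leftMate_comp_evaluation [ExactPairing X' X] [ExactPairing Y' Y] (f : X ⟶ Y) :
    X ◁ leftMate f ≫ ε_ X' X = f ▷ Y' ≫ ε_ Y' Y :=
  @leftAdjointMate_comp_evaluation C _ _ X Y ⟨X'⟩ ⟨Y'⟩ f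

theorem coevaluation_comp_rightMate [ExactPairing X X'] [ExactPairing Y Y'] (f : X ⟶ Y) :
    η_ Y Y' ≫ Y ◁ rightMate f = η_ X X' ≫ f ▷ X' :=
  @coevaluation_comp_rightAdjointMate C _ _ X Y ⟨X'⟩ ⟨Y'⟩ f

/-- By the zigzag identity an arrow is recovered from its pairing with an evaluation or a
coevaluation. This and the next two lemmas let identities between mates be checked after such a
pairing. -/
theorem whiskerLeft_comp_evaluation_injective [ExactPairing X' X] {Z : C} {f g : Z ⟶ X'}
    (h : X ◁ f ≫ ε_ X' X = X ◁ g ≫ ε_ X' X) : f = g := by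
  have key : ∀ k : Z ⟶ X', tensorLeftHomEquiv Z X' X (𝟙_ C) (X ◁ k ≫ ε_ X' X) =
      k ≫ (ρ_ X').inv :=
    fun k => @tensorLeftHomEquiv_whiskerLeft_comp_evaluation C _ _ Z X ⟨X'⟩ k
  exact (cancel_mono (ρ_ X').inv).1 (by rw [← key, ← key, h])

theorem coevaluation_comp_whiskerLeft_injective [ExactPairing X X'] {Z : C} {f g : X' ⟶ Z}
    (h : η_ X X' ≫ X ◁ f = η_ X X' ≫ X ◁ g) : f = g :=
  (cancel_epi (ρ_ X').hom).1 (by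
    rw [← tensorLeftHomEquiv_symm_coevaluation_comp_whiskerLeft (Y := X), h,
      tensorLeftHomEquiv_symm_coevaluation_comp_whiskerLeft])

theorem coevaluation_comp_whiskerRight_injective [ExactPairing X X'] {Z : C} {f g : X ⟶ Z}
    (h : η_ X X' ≫ f ▷ X' = η_ X X' ≫ g ▷ X') : f = g :=
  (cancel_epi (λ_ X).hom).1 (by
    rw [← tensorRightHomEquiv_symm_coevaluation_comp_whiskerRight (Y' := X'), h,
      tensorRightHomEquiv_symm_coevaluation_comp_whiskerRight])

/-- Both mates are characterised by sliding an arrow through the same coevaluations, in opposite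
directions. -/
theorem rightMate_leftMate [ExactPairing X X'] [ExactPairing Y Y'] (k : Y' ⟶ X') :
    rightMate (leftMate (X' := Y) (Y' := X) k) = k :=
  coevaluation_comp_whiskerLeft_injective (X := Y) (by
    rw [coevaluation_comp_rightMate, coevaluation_comp_leftMate])

/-- The pairing of X is nested inside that of Y. In this shape the left trace over X ⊗ Y splits into
a partial trace over X followed by a trace over Y. -/
theorem tensor_coevaluation_eq [ExactPairing X' X] [ExactPairing Y' Y] :
    η_ (Y' ⊗ X') (X ⊗ Y) = η_ Y' Y ≫ Y' ◁ (λ_ Y).inv ≫ Y' ◁ (η_ X' X ▷ Y) ≫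
      Y' ◁ (α_ X' X Y).hom ≫ (α_ Y' X' (X ⊗ Y)).inv := by
  rw [tensor_coevaluation]
  monoidal

theorem tensor_evaluation_eq [ExactPairing X' X] [ExactPairing Y' Y] :
    ε_ (Y' ⊗ X') (X ⊗ Y) = (α_ (X ⊗ Y) Y' X').inv ≫ (α_ X Y Y').hom ▷ X' ≫
      (X ◁ ε_ Y' Y) ▷ X' ≫ (ρ_ X).hom ▷ X' ≫ ε_ X' X := by
  rw [tensor_evaluation]
  monoidal

theorem TomitaFromCategory.IsSimpleObj.coevaluation_ne_zero [Preadditive C] [Linear ℂ C]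
    [MonoidalPreadditive C] [ExactPairing X' X] (hX : IsSimpleObj X) :
    η_ X' X ≠ 0 := fun h =>
  hX.1 (coevaluation_comp_whiskerLeft_injective (X := X') (by simp [h]))

/-- Mates carry endomorphisms of X' to endomorphisms of X, and scalars come from scalars. -/
theorem TomitaFromCategory.IsSimpleObj.of_exactPairing [Preadditive C] [Linear ℂ C]
    [MonoidalPreadditive C] [MonoidalLinear ℂ C] [ExactPairing X' X] (hX : IsSimpleObj X) :
    IsSimpleObj X' := by
  refine ⟨fun h => hX.1 ?_, fun f => ⟨coeff (rightMate (X' := X) (Y' := X) f), ?_⟩⟩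
  · apply coevaluation_comp_whiskerLeft_injective (X := X')
    rw [whiskerLeft_id, ← id_whiskerRight, h, MonoidalPreadditive.zero_whiskerRight,
      MonoidalPreadditive.whiskerLeft_zero]
  · apply coevaluation_comp_whiskerRight_injective (X' := X)
    rw [← coevaluation_comp_rightMate (X' := X) (Y' := X),
      hX.eq_coeff_smul (rightMate (X' := X) (Y' := X) f)]
    simp [MonoidalLinear.whiskerLeft_smul, MonoidalLinear.smul_whiskerRight, hX.coeff_smul_id]

end Mates

/-! ### Left, right and partial traces; spherical pairings -/

section Traces

open ExactPairing RigidCStarTensorCategory TomitaFromCategory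

variable {C : Type u} [Category.{v} C] [Preadditive C] [Linear ℂ C]
  [MonoidalCategory C] [MonoidalPreadditive C] [MonoidalLinear ℂ C] [RigidCStarTensorCategory C]

namespace RigidCStarTensorCategory

attribute [simp] dag_associator dag_leftUnitor dag_rightUnitor

@[simp]
theorem dag_whiskerLeft (X : C) {Y Z : C} (f : Y ⟶ Z) : dag (X ◁ f) = X ◁ dag f := by
  rw [← id_tensorHom, dag_tensor, dag_id, id_tensorHom]

@[simp]
theorem dag_whiskerRight {X Y : C} (f : X ⟶ Y) (Z : C) : dag (f ▷ Z) = dag f ▷ Z := by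
  rw [← tensorHom_id, dag_tensor, dag_id, tensorHom_id]

@[simp]
theorem dag_associator_inv (X Y Z : C) : dag (α_ X Y Z).inv = (α_ X Y Z).hom := by
  rw [← dag_associator, dag_dag]

@[simp]
theorem dag_leftUnitor_inv (X : C) : dag (λ_ X).inv = (λ_ X).hom := by
  rw [← dag_leftUnitor, dag_dag]

@[simp]
theorem dag_rightUnitor_inv (X : C) : dag (ρ_ X).inv = (ρ_ X).hom := by
  rw [← dag_rightUnitor, dag_dag]

end RigidCStarTensorCategory

/-- The adjoint of an exact pairing: the coevaluation is `ε*` and the evaluation is `η*`. -/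
@[reducible]
def CategoryTheory.ExactPairing.adjoint {X' X : C} (P : ExactPairing X' X) :
    ExactPairing X X' where
  coevaluation' := dag (ε_ X' X)
  evaluation' := dag (η_ X' X)
  coevaluation_evaluation' := by
    have h := congrArg dag (evaluation_coevaluation X' X)
    simp only [dag_comp, dag_whiskerLeft, dag_whiskerRight, dag_associator, dag_leftUnitor,
      dag_rightUnitor_inv, Category.assoc] at h
    exact h
  evaluation_coevaluation' := by
    have h := congrArg dag (coevaluation_evaluation X' X)
    simp only [dag_comp, dag_whiskerLeft, dag_whiskerRight, dag_associator_inv,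
      dag_leftUnitor_inv, dag_rightUnitor, Category.assoc] at h
    exact h

/-- The trace `η* (1 ⊗ T) η` of an endomorphism `T`. -/
def leftTrace (X' : C) {X : C} [ExactPairing X' X] (T : X ⟶ X) : 𝟙_ C ⟶ 𝟙_ C :=
  η_ X' X ≫ X' ◁ T ≫ dag (η_ X' X)

/-- The trace `ε (T ⊗ 1) ε*` of an endomorphism `T`. -/
def rightTrace (X' : C) {X : C} [ExactPairing X' X] (T : X ⟶ X) : 𝟙_ C ⟶ 𝟙_ C :=
  dag (ε_ X' X) ≫ T ▷ X' ≫ ε_ X' X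

theorem leftTrace_sub (X' : C) {X : C} [ExactPairing X' X] (S T : X ⟶ X) :
    leftTrace X' (S - T) = leftTrace X' S - leftTrace X' T := by
  have h : X' ◁ (S - T) = X' ◁ S - X' ◁ T := (tensorLeft X').map_sub
  simp [leftTrace, h]

/-- The partial trace of an endomorphism of `X ⊗ Y` over the left factor. -/
def leftPartialTrace (X' : C) {X Y : C} [ExactPairing X' X] (T : X ⊗ Y ⟶ X ⊗ Y) : Y ⟶ Y :=
  (λ_ Y).inv ≫ η_ X' X ▷ Y ≫ (α_ X' X Y).hom ≫ X' ◁ T ≫ (α_ X' X Y).inv ≫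
    dag (η_ X' X) ▷ Y ≫ (λ_ Y).hom

/-- The partial trace of an endomorphism of `X ⊗ Y` over the right factor. -/
def rightPartialTrace (Y' : C) {X Y : C} [ExactPairing Y' Y] (T : X ⊗ Y ⟶ X ⊗ Y) : X ⟶ X :=
  (ρ_ X).inv ≫ X ◁ dag (ε_ Y' Y) ≫ (α_ X Y Y').inv ≫ T ▷ Y' ≫ (α_ X Y Y').hom ≫
    X ◁ ε_ Y' Y ≫ (ρ_ X).hom

section Product

variable {X X' Y Y' : C} [ExactPairing X' X] [ExactPairing Y' Y]

theorem leftTrace_tensor (T : X ⊗ Y ⟶ X ⊗ Y) :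
    leftTrace (Y' ⊗ X') T = leftTrace Y' (leftPartialTrace X' T) := by
  simp only [leftTrace, leftPartialTrace, tensor_coevaluation_eq, dag_comp, dag_whiskerLeft,
    dag_whiskerRight, dag_associator, dag_associator_inv, dag_leftUnitor_inv]
  monoidal

theorem rightTrace_tensor (T : X ⊗ Y ⟶ X ⊗ Y) :
    rightTrace (Y' ⊗ X') T = rightTrace X' (rightPartialTrace Y' T) := by
  simp only [rightTrace, rightPartialTrace, tensor_evaluation_eq, dag_comp, dag_whiskerLeft,
    dag_whiskerRight, dag_associator, dag_associator_inv, dag_rightUnitor]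
  monoidal

/-- Both sides close the strand X on the left and the strand Y on the right. The two closures do not
interact, so by the interchange law their order is irrelevant. -/
theorem rightTrace_leftPartialTrace (T : X ⊗ Y ⟶ X ⊗ Y) :
    rightTrace Y' (leftPartialTrace X' T) = leftTrace X' (rightPartialTrace Y' T) := by
  calc
    _ = 𝟙 _ ⊗≫ (𝟙_ C ◁ dag (ε_ Y' Y) ≫ η_ X' X ▷ (Y ⊗ Y')) ⊗≫ X' ◁ T ▷ Y' ⊗≫
        (dag (η_ X' X) ▷ (Y ⊗ Y') ≫ 𝟙_ C ◁ ε_ Y' Y) ⊗≫ 𝟙 _ := by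
      simp only [rightTrace, leftPartialTrace]
      monoidal
    _ = 𝟙 _ ⊗≫ (η_ X' X ▷ 𝟙_ C ≫ (X' ⊗ X) ◁ dag (ε_ Y' Y)) ⊗≫ X' ◁ T ▷ Y' ⊗≫
        ((X' ⊗ X) ◁ ε_ Y' Y ≫ dag (η_ X' X) ▷ 𝟙_ C) ⊗≫ 𝟙 _ := by
      rw [whisker_exchange, whisker_exchange]
    _ = _ := by
      simp only [leftTrace, rightPartialTrace]
      monoidal

end Product

/-- An exact pairing is spherical if its left and right traces coincide. -/
def IsSpherical {X' X : C} (P : ExactPairing X' X) : Prop :=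
  ∀ T : X ⟶ X, leftTrace X' T = rightTrace X' T

/-- The left trace closes X and then Y on the left. Sphericity of Y moves the second loop to the
right, the closures are interchanged, and sphericity of X moves the remaining loop. -/
theorem IsSpherical.tensor {X X' Y Y' : C} {P : ExactPairing X' X} {Q : ExactPairing Y' Y}
    (hP : IsSpherical P) (hQ : IsSpherical Q) :
    IsSpherical (ExactPairing.tensor : ExactPairing (Y' ⊗ X') (X ⊗ Y)) := fun T => by
  rw [leftTrace_tensor, hQ, rightTrace_leftPartialTrace, hP, rightTrace_tensor]

theorem TomitaFromCategory.IsSimpleObj.isSpherical {X' X : C} (P : ExactPairing X' X)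
    (hX : IsSimpleObj X) (h : η_ X' X ≫ dag (η_ X' X) = dag (ε_ X' X) ≫ ε_ X' X) :
    IsSpherical P := fun T => by
  rw [hX.eq_coeff_smul T, leftTrace, rightTrace]
  simp [MonoidalLinear.whiskerLeft_smul, MonoidalLinear.smul_whiskerRight, h]

/-! ### From sphericity to the trace property -/

section Frobenius

variable {b b' X X' : C}

/-- The mate of `f : X ⟶ b` for the adjoint pairings. -/
def adjointMate (P : ExactPairing b' b) (Q : ExactPairing X' X) (f : X ⟶ b) : b' ⟶ X' :=
  @rightMate C _ _ X X' b b' Q.adjoint P.adjoint f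

theorem coevaluation_comp_adjointMate (P : ExactPairing b' b) (Q : ExactPairing X' X)
    (f : X ⟶ b) : dag (ε_ b' b) ≫ b ◁ adjointMate P Q f = dag (ε_ X' X) ≫ f ▷ X' :=
  @coevaluation_comp_rightMate C _ _ X X' b b' Q.adjoint P.adjoint f

theorem exists_adjointMate_eq (P : ExactPairing b' b) (Q : ExactPairing X' X) (k : b' ⟶ X') :
    ∃ f : X ⟶ b, adjointMate P Q f = k :=
  ⟨_, @rightMate_leftMate C _ _ X X' b b' Q.adjoint P.adjoint k⟩

/-- Paired with the evaluation of b, the two mates slide onto the strand b, where they compose to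
the scalar ζ*ξ. Only this mixed composite is computed directly; composites of mates of one kind give
traces instead. -/
theorem leftMate_comp_dag_adjointMate (P : ExactPairing b' b) (Q : ExactPairing X' X)
    (hb : IsSimpleObj b) (ξ ζ : b ⟶ X) :
    leftMate (dag ζ) ≫ dag (adjointMate P Q (dag ξ)) = coeff (ξ ≫ dag ζ) • 𝟙 b' := by
  apply whiskerLeft_comp_evaluation_injective (X := b)
  have h := congrArg dag (coevaluation_comp_adjointMate P Q (dag ξ))
  simp only [dag_comp, dag_whiskerLeft, dag_whiskerRight, dag_dag] at h
  rw [whiskerLeft_comp, Category.assoc, h, whisker_exchange_assoc, leftMate_comp_evaluation,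
    ← comp_whiskerRight_assoc, hb.eq_coeff_smul (ξ ≫ dag ζ), hb.coeff_smul_id]
  simp [MonoidalLinear.whiskerLeft_smul, MonoidalLinear.smul_whiskerRight]

/-- Moving both arrows to the dual strand turns a loop of X into a loop of b. The right trace does
the same with the mates for the adjoint pairings. -/
theorem leftTrace_dag_comp (P : ExactPairing b' b) (Q : ExactPairing X' X) (ξ ζ : b ⟶ X) :
    leftTrace X' (dag ζ ≫ ξ) =
      η_ b' b ≫ (leftMate (dag ζ) ≫ dag (leftMate (X' := X') (dag ξ))) ▷ b ≫
        dag (η_ b' b) := by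
  have h := congrArg dag (coevaluation_comp_leftMate (X' := X') (Y' := b') (dag ξ))
  simp only [dag_comp, dag_whiskerLeft, dag_whiskerRight, dag_dag] at h
  rw [leftTrace, comp_whiskerRight, Category.assoc, h, ← Category.assoc (η_ b' b),
    coevaluation_comp_leftMate, whiskerLeft_comp, Category.assoc, Category.assoc]

theorem rightTrace_dag_comp (P : ExactPairing b' b) (Q : ExactPairing X' X) (ξ ζ : b ⟶ X) :
    rightTrace X' (dag ζ ≫ ξ) =
      dag (ε_ b' b) ≫ b ◁ (adjointMate P Q (dag ζ) ≫ dag (adjointMate P Q (dag ξ))) ≫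
        ε_ b' b := by
  have h := congrArg dag (coevaluation_comp_adjointMate P Q (dag ξ))
  simp only [dag_comp, dag_whiskerLeft, dag_whiskerRight, dag_dag] at h
  rw [rightTrace, whiskerLeft_comp, Category.assoc, h, ← Category.assoc (dag (ε_ b' b)),
    coevaluation_comp_adjointMate, comp_whiskerRight, Category.assoc, Category.assoc]

/-- The trace property: if `b` is simple with a normalized pairing and the pairing of `X` is
spherical, then `Tr (ξ ζ*) = d_b ζ* ξ` for `ξ, ζ : b ⟶ X`. -/
theorem IsSpherical.leftTrace_dag_comp_eq {P : ExactPairing b' b} {Q : ExactPairing X' X}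
    (hunit : IsSimpleObj (𝟙_ C)) (hb : IsSimpleObj b)
    (hP : η_ b' b ≫ dag (η_ b' b) = dag (ε_ b' b) ≫ ε_ b' b)
    (hQ : IsSpherical Q) (ξ ζ : b ⟶ X) :
    leftTrace X' (dag ζ ≫ ξ) = coeff (ξ ≫ dag ζ) • (η_ b' b ≫ dag (η_ b' b)) := by
  -- The relation between ξ and ξ' says ξ' = Tξ, where T compares the two kinds of mates. Exchanging
  -- one mate for the other makes both traces mixed composites: the left trace of ξζ* is d_b ζ*Tξ,
  -- and the right trace of (Tξ)ζ* is d_b ζ*ξ.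
  have left : ∀ ξ ξ' : b ⟶ X, adjointMate P Q (dag ξ') = leftMate (dag ξ) → ∀ ζ : b ⟶ X,
      leftTrace X' (dag ζ ≫ ξ) = coeff (ξ' ≫ dag ζ) • (η_ b' b ≫ dag (η_ b' b)) := by
    intro ξ ξ' h ζ
    rw [leftTrace_dag_comp P Q, ← h, leftMate_comp_dag_adjointMate P Q hb]
    simp [MonoidalLinear.smul_whiskerRight]
  have right : ∀ ξ ξ' : b ⟶ X, adjointMate P Q (dag ξ') = leftMate (dag ξ) → ∀ ζ : b ⟶ X,
      rightTrace X' (dag ζ ≫ ξ') = coeff (ξ ≫ dag ζ) • (η_ b' b ≫ dag (η_ b' b)) := by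
    intro ξ ξ' h ζ
    have h1 := congrArg dag (leftMate_comp_dag_adjointMate P Q hb ζ ξ)
    rw [dag_comp, dag_dag, dag_smul, dag_id, ← hb.coeff_dag, dag_comp, dag_dag] at h1
    rw [rightTrace_dag_comp P Q, h, h1, hP]
    simp [MonoidalLinear.whiskerLeft_smul]
  have lift : ∀ ξ : b ⟶ X, ∃ ξ' : b ⟶ X, adjointMate P Q (dag ξ') = leftMate (dag ξ) := by
    intro ξ
    obtain ⟨f, hf⟩ := exists_adjointMate_eq P Q (leftMate (dag ξ))
    exact ⟨dag f, by rwa [dag_dag]⟩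
  have hd : coeff (η_ b' b ≫ dag (η_ b' b)) ≠ 0 := fun h =>
    hb.coevaluation_ne_zero (hunit.eq_zero_of_coeff h)
  obtain ⟨ξ', h'⟩ := lift ξ
  obtain ⟨ξ'', h''⟩ := lift ξ'
  -- T² = 1: the left and right traces of ξ'ζ* are d_b ζ*ξ'' and d_b ζ*ξ. Testing with ζ = ξ'' - ξ
  -- gives ζ*ζ = 0.
  have twice : ξ'' = ξ := by
    refine sub_eq_zero.1 (hb.eq_zero_of_coeff ?_)
    have h1 := (left ξ' ξ'' h'' (ξ'' - ξ)).symm.trans ((hQ _).trans (right ξ ξ' h' (ξ'' - ξ)))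
    have h2 := congrArg coeff h1
    rw [hunit.coeff_smul, hunit.coeff_smul] at h2
    rw [Preadditive.sub_comp, sub_eq_add_neg, ← neg_one_smul ℂ (ξ ≫ _), hb.coeff_add,
      hb.coeff_smul, mul_right_cancel₀ hd h2]
    ring
  -- The vector v = ξ - Tξ satisfies Tv = -v, so Tr(vv*) = -d_b v*v, whereas Tr(vv*) ≥ 0 and d_b >
  -- 0.
  have once : ξ - ξ' = 0 := by
    set v := ξ - ξ' with hv
    have h1 : leftTrace X' (dag v ≫ v) =
        -(coeff (v ≫ dag v) • (η_ b' b ≫ dag (η_ b' b))) := by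
      have e : leftTrace X' (dag v ≫ v) =
          leftTrace X' (dag v ≫ ξ) - leftTrace X' (dag v ≫ ξ') := by
        rw [← leftTrace_sub, ← Preadditive.comp_sub]
      rw [e, left ξ ξ' h', left ξ' ξ'' h'', twice, ← sub_smul, ← neg_smul]
      congr 1
      conv_rhs => rw [show v ≫ dag v = ξ ≫ dag v + (-1 : ℂ) • (ξ' ≫ dag v) by
        rw [neg_one_smul, ← sub_eq_add_neg, ← Preadditive.sub_comp]]
      rw [hb.coeff_add, hb.coeff_smul]
      ring
    have h2 : leftTrace X' (dag v ≫ v) =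
        (η_ X' X ≫ X' ◁ dag v) ≫ dag (η_ X' X ≫ X' ◁ dag v) := by
      simp [leftTrace]
    have h3 : 0 ≤ coeff (leftTrace X' (dag v ≫ v)) := h2 ▸ hunit.coeff_comp_dag_nonneg _
    rw [h1, ← neg_smul, hunit.coeff_smul, neg_mul] at h3
    have h4 := mul_nonneg (hb.coeff_comp_dag_nonneg v)
      (hunit.coeff_comp_dag_nonneg (η_ b' b))
    exact hb.eq_zero_of_coeff
      ((mul_eq_zero.1 (le_antisymm (neg_nonneg.1 h3) h4)).resolve_right hd)
  rw [left ξ ξ' h', ← sub_eq_zero.1 once]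

end Frobenius

end Traces

/-! ### Pairings of letters and the conjugation ξ ↦ ξ̄ -/

namespace TomitaFromCategory

open ExactPairing RigidCStarTensorCategory

variable {C : Type u} [Category.{v} C] [Preadditive C] [Linear ℂ C]
  [MonoidalCategory C] [MonoidalPreadditive C] [MonoidalLinear ℂ C] [RigidCStarTensorCategory C]

variable {R : Representatives C}

namespace StandardConjugates

variable (D : StandardConjugates R)

/-- The exact pairing of the objects of a letter and of its conjugate. -/
@[reducible]
def letterPairing : ∀ l : Letter R, ExactPairing (D.obj (Letter.bar l)) (D.obj l)
  | Sum.inl a => D.pairing a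
  | Sum.inr a => (D.pairing a).adjoint

theorem dag_evaluation_letterPairing (l : Letter R) :
    dag (D.letterPairing l).evaluation' = D.rBar l := by
  cases l with
  | inl a => rfl
  | inr a => exact dag_dag _

theorem isSpherical_letterPairing (l : Letter R) : IsSpherical (D.letterPairing l) := by
  cases l with
  | inl a => exact (R.simple _ a.2).isSpherical _ (D.normalized a)
  | inr a =>
    let := D.pairing a
    refine (IsSimpleObj.of_exactPairing (X' := D.conj a) (R.simple _ a.2)).isSpherical _ ?_
    change dag (D.pairing a).evaluation' ≫ dag (dag (D.pairing a).evaluation') =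
      dag (dag (D.pairing a).coevaluation') ≫ dag (D.pairing a).coevaluation'
    rw [dag_dag, dag_dag]
    exact (D.normalized a).symm

/-- The arrow r_ᾱ is the adjoint of the evaluation of the letter pairing, so ξ̄*ζ̄ is ξζ* with the
strand α closed on the right. -/
theorem homConj_comp_dag_homConj (t : Triple R) (ξ ζ : t.1.1 ⟶ t.2.1.1 ⊗ D.obj t.2.2) :
    D.homConj t ζ ≫ dag (D.homConj t ξ) =
      @rightPartialTrace C _ _ _ _ _ _ _ _ _ _ (D.letterPairing t.2.2) (dag ζ ≫ ξ) := by
  simp only [homConj, rightPartialTrace, ← D.dag_evaluation_letterPairing]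
  simp
  rfl

/-- Frobenius reciprocity: the adjoint of ξ̄ is the transpose of ξ in Hom(β₁ā, β₂), and conjugating
again transposes it back. For a letter ā the adjoint pairing plays the same role. -/
theorem homConj_homConj_inl (b₁ b₂ a : R.Idx) (ξ : b₁.1 ⟶ b₂.1 ⊗ D.obj (Sum.inl a)) :
    D.homConj (b₂, b₁, Sum.inr a) (D.homConj (b₁, b₂, Sum.inl a) ξ) = ξ := by
  let := D.pairing a
  have h : dag (D.homConj (b₁, b₂, Sum.inl a) ξ) =
      (tensorRightHomEquiv b₁.1 (D.conj a) a.1 b₂.1).symm ξ := by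
    simp [homConj, rBar]
    erw [dag_dag]
    rfl
  refine Eq.trans ?_ ((tensorRightHomEquiv b₁.1 (D.conj a) a.1 b₂.1).apply_symm_apply ξ)
  rw [← h]
  rfl

theorem homConj_homConj_inr (b₁ b₂ a : R.Idx) (ξ : b₁.1 ⟶ b₂.1 ⊗ D.obj (Sum.inr a)) :
    D.homConj (b₂, b₁, Sum.inl a) (D.homConj (b₁, b₂, Sum.inr a) ξ) = ξ := by
  let := (D.pairing a).adjoint
  have h : dag (D.homConj (b₁, b₂, Sum.inr a) ξ) =
      (tensorRightHomEquiv b₁.1 a.1 (D.conj a) b₂.1).symm ξ := by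
    simp [homConj, rBar]
    erw [dag_whiskerLeft]
    rfl
  refine Eq.trans ?_ ((tensorRightHomEquiv b₁.1 a.1 (D.conj a) b₂.1).apply_symm_apply ξ)
  rw [← h]
  rfl

theorem coeff_coevaluation_comp_dag (hunit : IsSimpleObj (𝟙_ C)) (a : R.Idx) :
    coeff (D.eta a ≫ dag (D.eta a)) = (D.dim a : ℂ) := by
  have h := hunit.coeff_comp_dag_nonneg (D.eta a)
  exact Complex.ext rfl (Complex.nonneg_iff.1 h).2.symm

theorem dim_pos (hunit : IsSimpleObj (𝟙_ C)) (a : R.Idx) : 0 < D.dim a := by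
  have h := hunit.coeff_comp_dag_nonneg (D.eta a)
  refine lt_of_le_of_ne (Complex.nonneg_iff.1 h).1 fun h0 => ?_
  let := D.pairing a
  refine IsSimpleObj.coevaluation_ne_zero (X' := D.conj a) (R.simple _ a.2)
    (hunit.eq_zero_of_coeff (f := D.eta a) ?_)
  rw [D.coeff_coevaluation_comp_dag hunit, ← h0, Complex.ofReal_zero]

/-- Two evaluations of the trace of ξζ* on β₂α: as the trace over β₂ of the partial trace ξ̄*ζ̄,
which is a scalar, and by the trace property for β₁. -/
theorem dim_mul_coeff_homConj (hunit : IsSimpleObj (𝟙_ C)) (t : Triple R)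
    (ξ ζ : t.1.1 ⟶ t.2.1.1 ⊗ D.obj t.2.2) :
    D.dim t.2.1 * coeff (D.homConj t ζ ≫ dag (D.homConj t ξ)) =
      D.dim t.1 * coeff (ξ ≫ dag ζ) := by
  let P := D.pairing t.2.1
  let Q := D.letterPairing t.2.2
  have hP : IsSpherical P := (R.simple _ t.2.1.2).isSpherical _ (D.normalized t.2.1)
  have h1 := (hP.tensor (D.isSpherical_letterPairing t.2.2)).leftTrace_dag_comp_eq
    (P := D.pairing t.1) hunit (R.simple _ t.1.2) (D.normalized t.1) ξ ζ
  rw [hP.tensor (D.isSpherical_letterPairing t.2.2), rightTrace_tensor,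
    ← D.homConj_comp_dag_homConj, ← hP,
    (R.simple _ t.2.1.2).eq_coeff_smul (D.homConj t ζ ≫ dag (D.homConj t ξ)), leftTrace] at h1
  have h2 := congrArg coeff h1
  simp only [MonoidalLinear.whiskerLeft_smul, Linear.smul_comp, Linear.comp_smul, whiskerLeft_id,
    Category.id_comp, hunit.coeff_smul] at h2
  have e : ∀ a : R.Idx, coeff ((D.pairing a).coevaluation' ≫ dag (D.pairing a).coevaluation') =
    (D.dim a : ℂ) := D.coeff_coevaluation_comp_dag hunit
  erw [e, e] at h2
  rw [mul_comm, h2, mul_comm]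

end StandardConjugates
end TomitaFromCategory

/-! ### `ℓ^∞` is the dual of `ℓ¹` -/

section Predual

variable {ι : Type u}

theorem norm_dual_apply_single_le [DecidableEq ι] (φ : StrongDual ℂ (lp (fun _ : ι => ℂ) 1))
    (i : ι) : ‖star (φ (lp.single 1 i 1))‖ ≤ ‖φ‖ := by
  have h := φ.le_opNorm (lp.single 1 i 1)
  rwa [lp.norm_single one_pos, norm_one, mul_one, ← norm_star] at h

open Classical in
/-- The conjugate linear isometry from the dual of `ℓ¹` to `ℓ^∞`. -/
def dualToLpInfty (ι : Type u) :
    StrongDual ℂ (lp (fun _ : ι => ℂ) 1) →ₗᵢ⋆[ℂ] lp (fun _ : ι => ℂ) ∞ where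
  toFun φ := ⟨fun i => star (φ (lp.single 1 i 1)), memℓp_infty ⟨‖φ‖, by
    rintro _ ⟨i, rfl⟩
    exact norm_dual_apply_single_le φ i⟩⟩
  map_add' φ ψ := lp.ext (funext fun i => star_add (φ (lp.single 1 i 1)) (ψ (lp.single 1 i 1)))
  map_smul' c φ := lp.ext (funext fun i => star_mul' c (φ (lp.single 1 i 1)))
  norm_map' φ := by
    refine le_antisymm (lp.norm_le_of_forall_le (norm_nonneg _)
      (norm_dual_apply_single_le φ)) (φ.opNorm_le_bound (norm_nonneg _) fun x => ?_)
    have h1 := (lp.hasSum_single ENNReal.one_ne_top x).mapL φ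
    have h2 := lp.hasSum_norm (p := 1) (by simp) x
    simp only [ENNReal.toReal_one, Real.rpow_one] at h2
    rw [← h1.tsum_eq]
    refine tsum_of_norm_bounded (h2.mul_left _) fun i => ?_
    have e := lp.single_smul (𝕜 := ℂ) (E := fun _ : ι => ℂ) 1 i (x i) 1
    rw [smul_eq_mul, mul_one] at e
    rw [e, map_smul, norm_smul, mul_comm]
    refine mul_le_mul_of_nonneg_right ?_ (norm_nonneg _)
    rw [← norm_star]
    exact lp.norm_apply_le_norm (E := fun _ : ι => ℂ) ENNReal.top_ne_zero
      ⟨fun i => star (φ (lp.single 1 i 1)), _⟩ i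

/-- The functional attached to a is x ↦ ∑ conj(a_i) x_i. The conjugate matches the conjugate
linearity of the isometry. -/
theorem dualToLpInfty_surjective (ι : Type u) : Function.Surjective (dualToLpInfty ι) := by
  classical
  intro a
  have hs : ∀ x : lp (fun _ : ι => ℂ) 1, Summable fun i => ‖star (a i) * x i‖ := fun x => by
    have h2 := lp.hasSum_norm (p := 1) (by simp) x
    simp only [ENNReal.toReal_one, Real.rpow_one] at h2
    refine Summable.of_nonneg_of_le (fun i => norm_nonneg _) (fun i => ?_)
      (h2.summable.mul_left ‖a‖)
    rw [norm_mul, norm_star]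
    gcongr
    exact lp.norm_apply_le_norm ENNReal.top_ne_zero _ i
  let φ : lp (fun _ : ι => ℂ) 1 →ₗ[ℂ] ℂ :=
    { toFun := fun x => ∑' i, star (a i) * x i
      map_add' := fun x y => by
        rw [← (hs x).of_norm.tsum_add (hs y).of_norm]
        simp [mul_add]
      map_smul' := fun c x => by
        rw [RingHom.id_apply, smul_eq_mul, ← tsum_mul_left]
        congr 1 with i
        simp only [lp.coeFn_smul, Pi.smul_apply, smul_eq_mul]
        ring }
  refine ⟨φ.mkContinuous ‖a‖ fun x => ?_, ?_⟩
  · have h2 := lp.hasSum_norm (p := 1) (by simp) x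
    simp only [ENNReal.toReal_one, Real.rpow_one] at h2
    refine tsum_of_norm_bounded (h2.mul_left _) fun i => ?_
    rw [norm_mul, norm_star]
    gcongr
    exact lp.norm_apply_le_norm ENNReal.top_ne_zero _ i
  · ext i
    change star (∑' j, star (a j) * lp.single (E := fun _ : ι => ℂ) 1 i 1 j) = a i
    rw [tsum_eq_single i fun j hj => by rw [lp.single_apply_ne _ _ _ hj, mul_zero],
      lp.single_apply_self, mul_one, star_star]

instance (ι : Type u) : WStarAlgebra (lp (fun _ : ι => ℂ) ∞) where
  exists_predual := ⟨lp (fun _ : ι => ℂ) 1, inferInstance, inferInstance, inferInstance,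
    ⟨LinearIsometryEquiv.ofSurjective (dualToLpInfty ι) (dualToLpInfty_surjective ι)⟩⟩

end Predual

/-! ### Order, normal functionals and the trace on `𝔄(𝟙)` -/

theorem nonneg_iff_exists_star_mul_self {A : Type*} [CStarAlgebra A] [PartialOrder A]
    [StarOrderedRing A] {a : A} : 0 ≤ a ↔ ∃ x : A, a = star x * x :=
  CStarAlgebra.nonneg_iff_eq_star_mul_self

namespace TomitaFromCategory

open TomitaBimodule

variable {C : Type u} [Category.{v} C] [Preadditive C] [Linear ℂ C]
  [MonoidalCategory C]

variable {R : Representatives C}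

theorem Alg.nonneg_iff {a : Alg R} : 0 ≤ a ↔ ∀ β, 0 ≤ a β := by
  constructor
  · intro h β
    obtain ⟨x, rfl⟩ := nonneg_iff_exists_star_mul_self.1 h
    exact star_mul_self_nonneg (x β)
  · intro h
    -- The coordinatewise square root is bounded, hence an element x of the algebra with a = x*x.
    have hmem : Memℓp (fun β => ((Real.sqrt (a β).re : ℝ) : ℂ)) ∞ := by
      refine memℓp_infty ⟨Real.sqrt ‖a‖, ?_⟩
      rintro _ ⟨β, rfl⟩
      beta_reduce
      rw [Complex.norm_real, Real.norm_of_nonneg (Real.sqrt_nonneg _)]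
      exact Real.sqrt_le_sqrt ((Complex.re_le_norm _).trans
        (lp.norm_apply_le_norm ENNReal.top_ne_zero a β))
    refine nonneg_iff_exists_star_mul_self.2 ⟨⟨_, hmem⟩, lp.ext (funext fun β => ?_)⟩
    have h1 := Complex.nonneg_iff.1 (h β)
    change a β = star ((Real.sqrt (a β).re : ℝ) : ℂ) * ((Real.sqrt (a β).re : ℝ) : ℂ)
    rw [Complex.star_def, Complex.conj_ofReal, ← Complex.ofReal_mul, Real.mul_self_sqrt h1.1]
    exact Complex.ext rfl h1.2.symm

theorem Alg.le_iff {a b : Alg R} : a ≤ b ↔ ∀ β, a β ≤ b β := by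
  rw [← sub_nonneg, Alg.nonneg_iff]
  exact forall_congr' fun β => sub_nonneg

theorem Alg.re_nonneg {a : Alg R} (h : 0 ≤ a) (β : R.Idx) : 0 ≤ (a β).re :=
  (Complex.nonneg_iff.1 (Alg.nonneg_iff.1 h β)).1

theorem Alg.eq_ofReal_re {a : Alg R} (h : 0 ≤ a) (β : R.Idx) : a β = ((a β).re : ℂ) :=
  Complex.ext rfl (Complex.nonneg_iff.1 (Alg.nonneg_iff.1 h β)).2.symm

open Classical in
theorem IncreasesTo.isLUB_apply {D : Set (Alg R)} {a : Alg R} (h : IncreasesTo D a)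
    (β : R.Idx) : IsLUB ((fun d : Alg R => (d β).re) '' D) (a β).re := by
  obtain ⟨⟨d₀, hd₀⟩, -, hpos, hlub⟩ := h
  have ha : 0 ≤ a := (hpos d₀ hd₀).trans (hlub.1 hd₀)
  refine ⟨?_, fun M hM => ?_⟩
  · rintro _ ⟨d, hd, rfl⟩
    exact (Complex.le_def.1 (Alg.le_iff.1 (hlub.1 hd) β)).1
  -- The element a with its β-coordinate replaced by M is still an upper bound, so it dominates the
  -- supremum a.
  · have hub : a + lp.single ∞ β ((M : ℂ) - a β) ∈ upperBounds D := by
      intro d hd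
      refine Alg.le_iff.2 fun γ => ?_
      by_cases hγ : γ = β
      · subst hγ
        have e : (a + lp.single ∞ γ ((M : ℂ) - a γ) : Alg R) γ = M := by
          rw [lp.coeFn_add, Pi.add_apply, lp.single_apply_self, add_sub_cancel]
        rw [e, Alg.eq_ofReal_re (hpos d hd)]
        exact Complex.real_le_real.2 (hM ⟨d, hd, rfl⟩)
      · have e : (a + lp.single ∞ β ((M : ℂ) - a β) : Alg R) γ = a γ := by
          rw [lp.coeFn_add, Pi.add_apply, lp.single_apply_ne _ _ _ hγ, add_zero]
        rw [e]
        exact Alg.le_iff.1 (hlub.1 hd) γ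
    have h1 := Alg.le_iff.1 (hlub.2 hub) β
    have e : (a + lp.single ∞ β ((M : ℂ) - a β) : Alg R) β = M := by
      rw [lp.coeFn_add, Pi.add_apply, lp.single_apply_self, add_sub_cancel]
    rw [e] at h1
    exact (Complex.le_def.1 h1).1

/-- Evaluation at `β`, as a linear functional on `𝔄(𝟙)`. -/
def Alg.eval (β : R.Idx) : Alg R →ₗ[ℂ] ℂ where
  toFun a := a β
  map_add' _ _ := rfl
  map_smul' _ _ := rfl

theorem Alg.isNormalFunctional_eval (β : R.Idx) : IsNormalFunctional (Alg.eval β) :=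
  ⟨fun _ ha => Alg.nonneg_iff.1 ha β, fun _ _ h => IncreasesTo.isLUB_apply h β⟩

theorem Alg.continuous_eval (β : R.Idx) :
    @Continuous (Alg R) ℂ (ultraweak (Alg R)) inferInstance (fun a => a β) :=
  continuous_iInf_dom (i := ⟨Alg.eval β, Alg.isNormalFunctional_eval β⟩) continuous_induced_dom

open Classical in
theorem Alg.sum_single_apply (s : Finset R.Idx) (f : R.Idx → ℂ) (γ : R.Idx) :
    (∑ β ∈ s, lp.single ∞ β (f β) : Alg R) γ = if γ ∈ s then f γ else 0 := by
  rw [lp.coeFn_sum, Finset.sum_apply]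
  simp_rw [lp.single_apply, Pi.single_apply]
  exact Finset.sum_ite_eq s γ _

namespace StandardConjugates

variable [MonoidalPreadditive C] [MonoidalLinear ℂ C] [RigidCStarTensorCategory C]
variable (D : StandardConjugates R)

/-- The sum over β is a supremum of finite sums, suprema commute with each other, and a finite sum
commutes with a supremum over a directed family. -/
theorem tau_eq_iSup (hunit : IsSimpleObj (𝟙_ C)) {E : Set (Alg R)} {a : Alg R}
    (h : IncreasesTo E a) : D.tau a = ⨆ d ∈ E, D.tau d := by
  have hE : Nonempty E := h.1.to_subtype
  have key : ∀ β, ENNReal.ofReal (D.dim β * (a β).re) =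
      ⨆ d : E, ENNReal.ofReal (D.dim β * (d.1 β).re) := by
    intro β
    have hm : Monotone fun x : ℝ => ENNReal.ofReal (D.dim β * x) := fun x y hxy =>
      ENNReal.ofReal_le_ofReal (mul_le_mul_of_nonneg_left hxy (D.dim_pos hunit β).le)
    have hl := IncreasesTo.isLUB_apply h β
    have hc : Continuous fun x : ℝ => ENNReal.ofReal (D.dim β * x) :=
      ENNReal.continuous_ofReal.comp (continuous_const.mul continuous_id)
    have := hm.map_csSup_of_continuousAt hc.continuousAt (h.1.image _) ⟨_, hl.1⟩
    rw [hl.csSup_eq (h.1.image _)] at this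
    rw [this, Set.image_image, sSup_image']
  have mono : ∀ d ∈ E, ∀ d' ∈ E, d ≤ d' → ∀ β, ENNReal.ofReal (D.dim β * (d β).re) ≤
      ENNReal.ofReal (D.dim β * (d' β).re) := fun d _ d' _ hdd β =>
    ENNReal.ofReal_le_ofReal (mul_le_mul_of_nonneg_left
      (Complex.le_def.1 (Alg.le_iff.1 hdd β)).1 (D.dim_pos hunit β).le)
  rw [iSup_subtype']
  simp only [tau]
  rw [ENNReal.tsum_eq_iSup_sum]
  simp_rw [ENNReal.tsum_eq_iSup_sum]
  rw [iSup_comm]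
  refine iSup_congr fun s => ?_
  simp_rw [key]
  refine ENNReal.finsetSum_iSup fun d d' => ?_
  obtain ⟨e, he, h1, h2⟩ := h.2.1 d.1 d.2 d'.1 d'.2
  exact ⟨⟨e, he⟩, fun β => ⟨mono _ d.2 _ he h1 β, mono _ d'.2 _ he h2 β⟩⟩

open Classical in
theorem isNSFTrace_tau (hunit : IsSimpleObj (𝟙_ C)) : IsNSFTrace D.tau where
  map_add a b ha hb := by
    simp only [tau]
    rw [← ENNReal.tsum_add]
    refine tsum_congr fun β => ?_
    rw [← ENNReal.ofReal_add (mul_nonneg (D.dim_pos hunit β).le (Alg.re_nonneg ha β))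
      (mul_nonneg (D.dim_pos hunit β).le (Alg.re_nonneg hb β)), ← mul_add]
    rfl
  map_smul r a ha := by
    simp only [tau]
    rw [← ENNReal.tsum_mul_left]
    refine tsum_congr fun β => ?_
    have e : ((((r : ℝ) : ℂ) • a : Alg R) β).re = r * (a β).re := by
      rw [lp.coeFn_smul, Pi.smul_apply, smul_eq_mul, Complex.re_ofReal_mul]
    rw [e, mul_left_comm, ENNReal.ofReal_mul r.coe_nonneg, ENNReal.ofReal_coe_nnreal]
  tracial a := by
    have e : star a * a = a * star a := lp.ext (funext fun β => mul_comm (star (a β)) (a β))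
    rw [e]
  faithful a ha h := by
    refine lp.ext (funext fun β => ?_)
    have h1 := ENNReal.ofReal_eq_zero.1 (ENNReal.tsum_eq_zero.1 h β)
    have h2 : (a β).re = 0 :=
      le_antisymm (nonpos_of_mul_nonpos_right h1 (D.dim_pos hunit β)) (Alg.re_nonneg ha β)
    rw [Alg.eq_ofReal_re ha, h2]
    rfl
  normal E a h := D.tau_eq_iSup hunit h
  semifinite a ha h := by
    obtain ⟨β, hβ⟩ : ∃ β, a β ≠ 0 := by
      by_contra hc
      push Not at hc
      exact h (lp.ext (funext hc))
    refine ⟨lp.single ∞ β (a β), Alg.nonneg_iff.2 fun γ => ?_, Alg.le_iff.2 fun γ => ?_,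
      fun h0 => hβ ?_, ?_⟩
    · by_cases hγ : γ = β
      · subst hγ
        rw [lp.single_apply_self]
        exact Alg.nonneg_iff.1 ha γ
      · rw [lp.single_apply_ne _ _ _ hγ]
    · by_cases hγ : γ = β
      · subst hγ
        rw [lp.single_apply_self]
      · rw [lp.single_apply_ne _ _ _ hγ]
        exact Alg.nonneg_iff.1 ha γ
    · have := congrArg (fun b : Alg R => b β) h0
      rwa [lp.single_apply_self] at this
    · rw [tau, tsum_eq_single β fun γ hγ => by
        rw [lp.single_apply_ne _ _ _ hγ, Complex.zero_re, mul_zero, ENNReal.ofReal_zero]]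
      exact ENNReal.ofReal_lt_top

open Classical in
theorem tau_sum_single (hunit : IsSimpleObj (𝟙_ C)) (s : Finset R.Idx) (f : R.Idx → ℝ)
    (hf : ∀ β, 0 ≤ f β) :
    0 ≤ (∑ β ∈ s, lp.single ∞ β (f β : ℂ) : Alg R) ∧
    D.tau (∑ β ∈ s, lp.single ∞ β (f β : ℂ)) = ENNReal.ofReal (∑ β ∈ s, D.dim β * f β) := by
  have e : ∀ γ, (∑ β ∈ s, lp.single ∞ β (f β : ℂ) : Alg R) γ = if γ ∈ s then (f γ : ℂ) else 0 :=
    Alg.sum_single_apply s _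
  constructor
  · refine Alg.nonneg_iff.2 fun γ => ?_
    rw [e]
    split_ifs
    · exact Complex.zero_le_real.2 (hf γ)
    · exact le_rfl
  · rw [tau, tsum_eq_sum (s := s) fun γ hγ => by
      rw [e, if_neg hγ, Complex.zero_re, mul_zero, ENNReal.ofReal_zero],
      ENNReal.ofReal_sum_of_nonneg fun β _ => mul_nonneg (D.dim_pos hunit β).le (hf β)]
    refine Finset.sum_congr rfl fun γ hγ => ?_
    rw [e, if_pos hγ, Complex.ofReal_re]

open Classical in
-- The positive and negative parts of the real and imaginary parts, coordinate by coordinate, give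
-- an admissible decomposition of finite weight.
theorem extend_tau_eq_sum (hunit : IsSimpleObj (𝟙_ C)) (s : Finset R.Idx) {a : Alg R}
    (ha : ∀ β ∉ s, a β = 0) : extend D.tau a = ∑ β ∈ s, D.dim β * a β := by
  let P : (R.Idx → ℝ) → Alg R := fun f => ∑ β ∈ s, lp.single ∞ β (f β : ℂ)
  have hP : ∀ f γ, P f γ = if γ ∈ s then (f γ : ℂ) else 0 := fun f =>
    Alg.sum_single_apply s _
  have pos : ∀ f : R.Idx → ℝ, (∀ β, 0 ≤ f β) → 0 ≤ P f := fun f hf =>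
    (D.tau_sum_single hunit s f hf).1
  have tau : ∀ f : R.Idx → ℝ, (∀ β, 0 ≤ f β) →
      D.tau (P f) = ENNReal.ofReal (∑ β ∈ s, D.dim β * f β) := fun f hf =>
    (D.tau_sum_single hunit s f hf).2
  have tauR : ∀ f : R.Idx → ℝ, (∀ β, 0 ≤ f β) →
      (D.tau (P f)).toReal = ∑ β ∈ s, D.dim β * f β := fun f hf => by
    rw [tau f hf, ENNReal.toReal_ofReal
      (Finset.sum_nonneg fun β _ => mul_nonneg (D.dim_pos hunit β).le (hf β))]
  have fin : ∀ f : R.Idx → ℝ, (∀ β, 0 ≤ f β) → D.tau (P f) < ∞ := fun f hf => by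
    rw [tau f hf]
    exact ENNReal.ofReal_lt_top
  have h₁ : ∀ β, 0 ≤ max (a β).re 0 := fun β => le_max_right _ _
  have h₂ : ∀ β, 0 ≤ max (-(a β).re) 0 := fun β => le_max_right _ _
  have h₃ : ∀ β, 0 ≤ max (a β).im 0 := fun β => le_max_right _ _
  have h₄ : ∀ β, 0 ≤ max (-(a β).im) 0 := fun β => le_max_right _ _
  have hx : IsFiniteDecomposition D.tau a
      (P fun β => max (a β).re 0, P fun β => max (-(a β).re) 0,
        P fun β => max (a β).im 0, P fun β => max (-(a β).im) 0) := by
    refine ⟨⟨pos _ h₁, pos _ h₂, pos _ h₃, pos _ h₄⟩, ⟨fin _ h₁, fin _ h₂, fin _ h₃, fin _ h₄⟩,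
      lp.ext (funext fun β => ?_)⟩
    simp only [lp.coeFn_add, lp.coeFn_sub, lp.coeFn_smul, Pi.add_apply, Pi.sub_apply,
      Pi.smul_apply, hP]
    split_ifs with hβ
    · rw [← Complex.ofReal_sub, ← Complex.ofReal_sub, max_zero_sub_eq_self, max_zero_sub_eq_self,
        smul_eq_mul, mul_comm, Complex.re_add_im]
    · simp [ha β hβ]
  rw [extend_eq (D.isNSFTrace_tau hunit) hx]
  simp only [tauR _ h₁, tauR _ h₂, tauR _ h₃, tauR _ h₄]
  rw [← Finset.sum_sub_distrib, ← Finset.sum_sub_distrib, Complex.ofReal_sum, Complex.ofReal_sum,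
    Finset.mul_sum, ← Finset.sum_add_distrib]
  refine Finset.sum_congr rfl fun β _ => ?_
  rw [← mul_sub, ← mul_sub, max_zero_sub_eq_self, max_zero_sub_eq_self]
  conv_rhs => rw [← Complex.re_add_im (a β)]
  push_cast
  ring

end StandardConjugates
end TomitaFromCategory

theorem norm_le_norm_of_nonneg_of_le_of_cstar {A : Type*} [CStarAlgebra A] [PartialOrder A]
    [StarOrderedRing A] {a b : A} (ha : 0 ≤ a) (hab : a ≤ b) : ‖a‖ ≤ ‖b‖ :=
  CStarAlgebra.norm_le_norm_of_nonneg_of_le ha hab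

/-- The space is abstract so that the ultraweak topology can be supplied in place of the norm
topology. -/
theorem continuous_sum_mul_const {ι T : Type*} [TopologicalSpace T] (s : Finset ι)
    {e : ι → T → ℂ} (he : ∀ i, Continuous (e i)) (k : ι → ℂ) :
    Continuous fun a => ∑ i ∈ s, e i a * k i := by fun_prop

/-! ### The bimodule `H(𝟙)` -/

namespace TomitaFromCategory

open TomitaBimodule

variable {C : Type u} [Category.{v} C] [Preadditive C] [Linear ℂ C]
  [MonoidalCategory C]

variable {R : Representatives C}

theorem Triple.bar_injective : Function.Injective (Triple.bar : Triple R → Triple R) := by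
  rintro ⟨b₁, b₂, (a | a)⟩ ⟨b₁', b₂', (a' | a')⟩ h <;> simp_all

theorem Triple.bar_surjective : Function.Surjective (Triple.bar : Triple R → Triple R) := by
  rintro ⟨b₁, b₂, (a | a)⟩
  exacts [⟨(b₂, b₁, Sum.inr a), rfl⟩, ⟨(b₂, b₁, Sum.inl a), rfl⟩]

theorem letterScalar_pos {lam : R.Idx → ℝ} (hlam : ∀ a, 0 < lam a) (l : Letter R) :
    0 < letterScalar lam l := by
  cases l with
  | inl a => exact hlam a
  | inr a => exact one_div_pos.2 (hlam a)

theorem letterScalar_bar (lam : R.Idx → ℝ) (l : Letter R) :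
    letterScalar lam (Letter.bar l) = (letterScalar lam l)⁻¹ := by
  cases l with
  | inl a => exact one_div _
  | inr a =>
    change lam a = (1 / lam a)⁻¹
    rw [one_div, inv_inv]

theorem letterScalar_ne_zero {lam : R.Idx → ℝ} (hlam : ∀ a, 0 < lam a) (l : Letter R) :
    (letterScalar lam l : ℂ) ≠ 0 :=
  Complex.ofReal_ne_zero.2 (letterScalar_pos hlam l).ne'

/-- The conjugate of λ^{iz} is λ^{-i z̄} = (1/λ)^{i z̄}. The inverse is absorbed by passing to the
conjugate letter, which is why SU(z) = U(z̄)S. -/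
theorem star_letterScalar_cpow {lam : R.Idx → ℝ} (hlam : ∀ a, 0 < lam a) (l : Letter R) (z : ℂ) :
    star ((letterScalar lam l : ℂ) ^ (Complex.I * z)) =
      (letterScalar lam (Letter.bar l) : ℂ) ^ (Complex.I * star z) := by
  have h := letterScalar_pos hlam l
  rw [letterScalar_bar, Complex.cpow_def_of_ne_zero (letterScalar_ne_zero hlam l),
    Complex.cpow_def_of_ne_zero (Complex.ofReal_ne_zero.2 (inv_pos.2 h).ne'),
    ← Complex.ofReal_log h.le, ← Complex.ofReal_log (inv_pos.2 h).le, Real.log_inv,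
    Complex.star_def, ← Complex.exp_conj]
  congr 1
  simp

theorem star_letterScalar_cpow_neg_star {lam : R.Idx → ℝ} (hlam : ∀ a, 0 < lam a)
    (l : Letter R) (z : ℂ) :
    star ((letterScalar lam l : ℂ) ^ (Complex.I * -star z)) =
      (letterScalar lam l : ℂ) ^ (Complex.I * z) := by
  have h := letterScalar_pos hlam l
  rw [Complex.cpow_def_of_ne_zero (letterScalar_ne_zero hlam l),
    Complex.cpow_def_of_ne_zero (letterScalar_ne_zero hlam l),
    ← Complex.ofReal_log h.le, Complex.star_def, ← Complex.exp_conj]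
  congr 1
  simp

theorem differentiable_letterScalar_cpow {lam : R.Idx → ℝ} (hlam : ∀ a, 0 < lam a) (l : Letter R) :
    Differentiable ℂ fun z : ℂ => (letterScalar lam l : ℂ) ^ (Complex.I * z) := fun _ =>
  ((differentiableAt_id.const_mul Complex.I).const_cpow (Or.inl (letterScalar_ne_zero hlam l)))

namespace StandardConjugates

variable [MonoidalPreadditive C] [MonoidalLinear ℂ C] [RigidCStarTensorCategory C]
variable (D : StandardConjugates R)

/-- The inner product `ξ* ζ ∈ End β₁ = ℂ` on `Hom(β₁, β₂ α)`. -/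
def homInner {t : Triple R} (x y : D.HomSpace t) : ℂ := coeff (D.toHom y ≫ dag (D.toHom x))

/-! ### The inner product on a single Hom space -/

section HomInner

variable {t : Triple R}

theorem homInner_add_left (x y z : D.HomSpace t) :
    D.homInner (x + y) z = D.homInner x z + D.homInner y z := by
  refine Eq.trans (congrArg coeff ?_) ((R.simple _ t.1.2).coeff_add _ _)
  exact (congrArg (D.toHom z ≫ ·) (dag_add _ _)).trans (Preadditive.comp_add _ _ _ _ _ _)

theorem homInner_add_right (x y z : D.HomSpace t) :
    D.homInner x (y + z) = D.homInner x y + D.homInner x z :=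
  Eq.trans (congrArg coeff (Preadditive.add_comp _ _ _ _ _ _)) ((R.simple _ t.1.2).coeff_add _ _)

theorem homInner_smul_left (c : ℂ) (x y : D.HomSpace t) :
    D.homInner (c • x) y = star c * D.homInner x y := by
  refine Eq.trans (congrArg coeff ?_) ((R.simple _ t.1.2).coeff_smul _ _)
  exact (congrArg (D.toHom y ≫ ·) (dag_smul _ _)).trans (Linear.comp_smul _ _ _ _ _ _)

theorem homInner_smul_right (c : ℂ) (x y : D.HomSpace t) :
    D.homInner x (c • y) = c * D.homInner x y :=
  Eq.trans (congrArg coeff (Linear.smul_comp _ _ _ _ _ _)) ((R.simple _ t.1.2).coeff_smul _ _)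

theorem homInner_zero_left (y : D.HomSpace t) : D.homInner 0 y = 0 := by
  rw [← zero_smul ℂ (0 : D.HomSpace t), homInner_smul_left, star_zero, zero_mul]

theorem homInner_self_nonneg (x : D.HomSpace t) : 0 ≤ D.homInner x x :=
  (R.simple _ t.1.2).coeff_comp_dag_nonneg _

theorem homInner_self_eq_zero {x : D.HomSpace t} (h : D.homInner x x = 0) : x = 0 :=
  (R.simple _ t.1.2).eq_zero_of_coeff h

theorem homConjHom_smul (c : ℂ) (x : D.HomSpace t) :
    D.homConjHom t (c • x) = star c • D.homConjHom t x := by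
  change D.homConj t (c • D.toHom x) = star c • D.homConj t (D.toHom x)
  simp [homConj, MonoidalLinear.smul_whiskerRight]

theorem dim_mul_homInner_homConjHom (hunit : IsSimpleObj (𝟙_ C)) (x y : D.HomSpace t) :
    D.dim t.2.1 * D.homInner (D.homConjHom t x) (D.homConjHom t y) =
      D.dim t.1 * D.homInner y x :=
  D.dim_mul_coeff_homConj hunit t x y

end HomInner

/-! ### Formulas in coordinates -/

section Coordinates

open Classical in
-- Any finite set outside which ξ vanishes may index the sum, so that inner products of different
-- vectors can be compared term by term.
theorem ip_eq_sum {ξ : D.Hbim} (ζ : D.Hbim) {s : Finset (Triple R)} (hs : ∀ t ∉ s, ξ t = 0) :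
    D.ip ξ ζ = ∑ t ∈ s, lp.single ∞ t.1 (D.homInner (ξ t) (ζ t)) := by
  refine Finset.sum_subset (fun t ht => ?_) fun t _ ht => ?_
  · by_contra h
    exact (DFinsupp.mem_support_iff.1 ht) (hs t h)
  · have h0 : ξ t = 0 := DFinsupp.notMem_support_iff.1 ht
    change (lp.single ∞ t.1 (D.homInner (ξ t) (ζ t)) : Alg R) = 0
    rw [h0, homInner_zero_left, lp.single_zero]

open Classical in
theorem eq_zero_of_notMem_support {ξ : D.Hbim} {t : Triple R} (h : t ∉ DFinsupp.support ξ) :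
    ξ t = 0 := DFinsupp.notMem_support_iff.1 h

open Classical in
theorem ip_apply {ξ : D.Hbim} (ζ : D.Hbim) {s : Finset (Triple R)} (hs : ∀ t ∉ s, ξ t = 0)
    (β : R.Idx) :
    D.ip ξ ζ β = ∑ t ∈ s, if t.1 = β then D.homInner (ξ t) (ζ t) else 0 := by
  rw [D.ip_eq_sum ζ hs, lp.coeFn_sum, Finset.sum_apply]
  refine Finset.sum_congr rfl fun t _ => ?_
  rw [lp.single_apply, Pi.single_apply]
  exact if_congr eq_comm rfl rfl

open Classical in
theorem scalarInner_eq_sum (hunit : IsSimpleObj (𝟙_ C)) {ξ : D.Hbim} (ζ : D.Hbim)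
    {s : Finset (Triple R)} (hs : ∀ t ∉ s, ξ t = 0) :
    scalarInner D.tau D.ip ξ ζ = ∑ t ∈ s, D.dim t.1 * D.homInner (ξ t) (ζ t) := by
  rw [scalarInner, D.extend_tau_eq_sum hunit (s.image Prod.fst)]
  · simp_rw [D.ip_apply ζ hs, Finset.mul_sum]
    rw [Finset.sum_comm]
    refine Finset.sum_congr rfl fun t ht => ?_
    rw [Finset.sum_eq_single_of_mem t.1 (Finset.mem_image_of_mem _ ht) fun β _ hβ => by
      rw [if_neg hβ.symm, mul_zero], if_pos rfl]
  · intro β hβ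
    rw [D.ip_apply ζ hs]
    refine Finset.sum_eq_zero fun t ht => if_neg fun h => hβ ?_
    exact h ▸ Finset.mem_image_of_mem _ ht

theorem left_smul_apply (a : Alg R) (ξ : D.Hbim) (t : Triple R) :
    (a • ξ) t = a t.2.1 • ξ t := rfl

theorem right_smul_apply (a : Alg R) (ξ : D.Hbim) (t : Triple R) :
    (MulOpposite.op a • ξ) t = a t.1 • ξ t := rfl

theorem oneParam_apply (lam : R.Idx → ℝ) (z : ℂ) (ξ : D.Hbim) (t : Triple R) :
    D.oneParam lam z ξ t = ((letterScalar lam t.2.2 : ℂ) ^ (Complex.I * z)) • ξ t := by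
  rw [oneParam, DirectSum.lmap_apply]
  rfl

open Classical in
-- Evaluating at t̄ avoids transport along the identification of the double conjugate of t with t.
-- As t ↦ t̄ is a bijection, these components determine Sξ.
theorem invol_apply_bar (lam : R.Idx → ℝ) (ξ : D.Hbim) (t : Triple R) :
    D.invol lam ξ (Triple.bar t) =
      ((Real.sqrt (letterScalar lam t.2.2) : ℝ) : ℂ) • D.homConjHom t (ξ t) := by
  induction ξ using DirectSum.induction_on with
  | zero => rw [map_zero, DirectSum.zero_apply, DirectSum.zero_apply, map_zero, smul_zero]
  | of u x =>
    rw [invol, DirectSum.toAddMonoid_of]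
    by_cases h : u = t
    · subst h
      rw [DirectSum.of_eq_same]
      exact DirectSum.of_eq_same _ _
    · rw [DirectSum.of_eq_of_ne u t x (Ne.symm h), map_zero, smul_zero]
      exact DirectSum.of_eq_of_ne _ _ _ fun h' => h (Triple.bar_injective h'.symm)
  | add ξ ζ hξ hζ =>
    rw [map_add, DirectSum.add_apply, DirectSum.add_apply, hξ, hζ, map_add, smul_add]

end Coordinates

end StandardConjugates
end TomitaFromCategory

/-! ### Verification of the Tomita bimodule axioms -/

namespace TomitaFromCategory

open TomitaBimodule

namespace StandardConjugates

variable {C : Type u} [Category.{v} C] [Preadditive C] [Linear ℂ C]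
  [MonoidalCategory C] [MonoidalPreadditive C] [MonoidalLinear ℂ C] [RigidCStarTensorCategory C]

variable {R : Representatives C}

variable (D : StandardConjugates R)

theorem ip_self_nonneg (ξ : D.Hbim) : 0 ≤ D.ip ξ ξ := by
  classical
  refine Alg.nonneg_iff.2 fun β => ?_
  rw [D.ip_apply ξ fun t => D.eq_zero_of_notMem_support]
  refine Finset.sum_nonneg fun t _ => ?_
  split_ifs
  · exact D.homInner_self_nonneg _
  · exact le_rfl

theorem eq_zero_of_ip_self {ξ : D.Hbim} (h : D.ip ξ ξ = 0) : ξ = 0 := by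
  classical
  refine DFinsupp.ext fun t => ?_
  by_contra ht
  have h1 := congrArg (fun a : Alg R => a t.1) h
  rw [D.ip_apply ξ fun t => D.eq_zero_of_notMem_support] at h1
  have h2 := (Finset.sum_eq_zero_iff_of_nonneg fun u _ => by
    split_ifs
    · exact D.homInner_self_nonneg _
    · exact le_rfl).1 h1 t (DFinsupp.mem_support_iff.2 ht)
  rw [if_pos rfl] at h2
  exact ht (D.homInner_self_eq_zero h2)

theorem moduleNorm_left_smul_le (a : Alg R) (ξ : D.Hbim) :
    moduleNorm D.ip (a • ξ) ≤ ‖a‖ * moduleNorm D.ip ξ := by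
  classical
  have h0 : ∀ t ∉ DFinsupp.support ξ, ξ t = 0 := fun t => D.eq_zero_of_notMem_support
  have h1 : ∀ t ∉ DFinsupp.support ξ, (a • ξ) t = 0 := fun t ht => by
    rw [left_smul_apply, h0 t ht, smul_zero]
  -- Each summand is scaled by |a_{β₂}|² ≤ ‖a‖²; monotonicity of the norm on positive elements does
  -- the rest.
  have hle : D.ip (a • ξ) (a • ξ) ≤ ((‖a‖ ^ 2 : ℝ) : ℂ) • D.ip ξ ξ := by
    refine Alg.le_iff.2 fun β => ?_
    rw [lp.coeFn_smul, Pi.smul_apply, D.ip_apply _ h1, D.ip_apply _ h0, Finset.smul_sum]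
    refine Finset.sum_le_sum fun t _ => ?_
    split_ifs
    · rw [left_smul_apply, homInner_smul_left, homInner_smul_right, ← mul_assoc, smul_eq_mul]
      refine mul_le_mul_of_nonneg_right ?_ (D.homInner_self_nonneg _)
      rw [Complex.star_def, ← Complex.normSq_eq_conj_mul_self, Complex.normSq_eq_norm_sq]
      exact Complex.real_le_real.2 (pow_le_pow_left₀ (norm_nonneg _)
        (lp.norm_apply_le_norm ENNReal.top_ne_zero a _) 2)
    · rw [smul_zero]
  have hn := norm_le_norm_of_nonneg_of_le_of_cstar (D.ip_self_nonneg (a • ξ)) hle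
  rw [norm_smul, Complex.norm_real, Real.norm_of_nonneg (sq_nonneg _)] at hn
  rw [moduleNorm, moduleNorm]
  refine (Real.sqrt_le_sqrt hn).trans (le_of_eq ?_)
  rw [Real.sqrt_mul (sq_nonneg _), Real.sqrt_sq (norm_nonneg _)]

open Classical in
theorem isPreHilbertBimodule : IsPreHilbertBimodule (A := Alg R) D.ip where
  left_scalar c ξ := DFinsupp.ext fun t => by
    change (algebraMap ℂ (Alg R) c) t.2.1 • ξ t = c • ξ t
    rfl
  right_scalar c ξ := DFinsupp.ext fun t => by
    change (algebraMap ℂ (Alg R) c) t.1 • ξ t = c • ξ t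
    rfl
  left_right a b ξ := DFinsupp.ext fun t => smul_comm (a t.2.1) (b t.1) (ξ t)
  add_left ξ₁ ξ₂ ζ := by
    have h₁ : ∀ t ∉ DFinsupp.support ξ₁ ∪ DFinsupp.support ξ₂, ξ₁ t = 0 := fun t ht =>
      D.eq_zero_of_notMem_support fun h => ht (Finset.mem_union_left _ h)
    have h₂ : ∀ t ∉ DFinsupp.support ξ₁ ∪ DFinsupp.support ξ₂, ξ₂ t = 0 := fun t ht =>
      D.eq_zero_of_notMem_support fun h => ht (Finset.mem_union_right _ h)
    have h₃ : ∀ t ∉ DFinsupp.support ξ₁ ∪ DFinsupp.support ξ₂, (ξ₁ + ξ₂) t = 0 := fun t ht => by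
      rw [DirectSum.add_apply, h₁ t ht, h₂ t ht, add_zero]
    rw [D.ip_eq_sum _ h₁, D.ip_eq_sum _ h₂, D.ip_eq_sum _ h₃, ← Finset.sum_add_distrib]
    refine Finset.sum_congr rfl fun t _ => ?_
    rw [DirectSum.add_apply, homInner_add_left, lp.single_add]
  add_right ξ ζ₁ ζ₂ := by
    have h : ∀ t ∉ DFinsupp.support ξ, ξ t = 0 := fun t => D.eq_zero_of_notMem_support
    rw [D.ip_eq_sum _ h, D.ip_eq_sum _ h, D.ip_eq_sum _ h, ← Finset.sum_add_distrib]
    refine Finset.sum_congr rfl fun t _ => ?_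
    rw [DirectSum.add_apply, homInner_add_right, lp.single_add]
  smul_left c ξ ζ := by
    have h : ∀ t ∉ DFinsupp.support ξ, ξ t = 0 := fun t => D.eq_zero_of_notMem_support
    have h' : ∀ t ∉ DFinsupp.support ξ, (c • ξ) t = 0 := fun t ht => by
      rw [DirectSum.smul_apply, h t ht, smul_zero]
    rw [D.ip_eq_sum _ h, D.ip_eq_sum _ h', Finset.smul_sum]
    refine Finset.sum_congr rfl fun t _ => ?_
    rw [DirectSum.smul_apply, homInner_smul_left, ← smul_eq_mul, lp.single_smul]
  smul_right c ξ ζ := by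
    have h : ∀ t ∉ DFinsupp.support ξ, ξ t = 0 := fun t => D.eq_zero_of_notMem_support
    rw [D.ip_eq_sum _ h, D.ip_eq_sum _ h, Finset.smul_sum]
    refine Finset.sum_congr rfl fun t _ => ?_
    rw [DirectSum.smul_apply, homInner_smul_right, ← smul_eq_mul, lp.single_smul]
  ip_action a b ξ ζ := by
    have h : ∀ t ∉ DFinsupp.support ξ, ξ t = 0 := fun t => D.eq_zero_of_notMem_support
    have h' : ∀ t ∉ DFinsupp.support ξ, (star b • ξ) t = 0 := fun t ht => by
      rw [left_smul_apply, h t ht, smul_zero]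
    refine lp.ext (funext fun β => ?_)
    rw [lp.infty_coeFn_mul, Pi.mul_apply, D.ip_apply _ h, D.ip_apply _ h', Finset.sum_mul]
    refine Finset.sum_congr rfl fun t _ => ?_
    split_ifs with hβ
    · rw [left_smul_apply, right_smul_apply, left_smul_apply, homInner_smul_right,
        homInner_smul_right, homInner_smul_left, lp.star_apply, star_star, hβ]
      ring
    · rw [zero_mul]
  ip_nonneg := D.ip_self_nonneg
  ip_definite _ := D.eq_zero_of_ip_self
  norm_left_action := D.moduleNorm_left_smul_le

theorem hasNormalLeftAction : HasNormalLeftAction (A := Alg R) D.ip := by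
  classical
  intro ξ
  refine @Continuous.continuousOn _ _ (ultraweak (Alg R)) (ultraweak (Alg R)) _ _ ?_
  refine continuous_iInf_rng.2 fun φ => continuous_induced_rng.2 ?_
  -- Composed with a normal functional, the map is a finite combination of coordinates of a, and
  -- coordinates are themselves normal functionals.
  have e : (φ.1 ∘ fun a : Alg R => D.ip ξ (a • ξ)) = fun a : Alg R =>
      ∑ t ∈ DFinsupp.support ξ, a t.2.1 * φ.1 (lp.single ∞ t.1 (D.homInner (ξ t) (ξ t))) := by
    funext a
    rw [Function.comp_apply, D.ip_eq_sum _ fun t => D.eq_zero_of_notMem_support, map_sum]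
    refine Finset.sum_congr rfl fun t _ => ?_
    rw [left_smul_apply, homInner_smul_right, ← smul_eq_mul, lp.single_smul, map_smul,
      smul_eq_mul]
  rw [e]
  exact @continuous_sum_mul_const _ _ (ultraweak (Alg R)) _
    (fun (t : Triple R) (a : Alg R) => a t.2.1) (fun t : Triple R => Alg.continuous_eval t.2.1) _

theorem tau_ip_self_lt_top (ξ : D.Hbim) : D.tau (D.ip ξ ξ) < ∞ := by
  classical
  rw [tau, tsum_eq_sum (s := (DFinsupp.support ξ).image Prod.fst) fun β hβ => ?_]
  · exact ENNReal.sum_lt_top.2 fun _ _ => ENNReal.ofReal_lt_top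
  · rw [D.ip_apply ξ fun t => D.eq_zero_of_notMem_support, Finset.sum_eq_zero fun t ht => if_neg
      fun h : t.1 = β => hβ (h ▸ Finset.mem_image_of_mem _ ht), Complex.zero_re, mul_zero,
      ENNReal.ofReal_zero]

section OneParam

variable {lam : R.Idx → ℝ}

theorem oneParam_add (hlam : ∀ a, 0 < lam a) (z w : ℂ) (ξ : D.Hbim) :
    D.oneParam lam (z + w) ξ = D.oneParam lam z (D.oneParam lam w ξ) :=
  DFinsupp.ext fun t => by
    rw [oneParam_apply, oneParam_apply, oneParam_apply, smul_smul, mul_add,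
      Complex.cpow_add _ _ (letterScalar_ne_zero hlam _)]

theorem oneParam_zero (ξ : D.Hbim) : D.oneParam lam 0 ξ = ξ :=
  DFinsupp.ext fun t => by
    rw [oneParam_apply, mul_zero, Complex.cpow_zero, one_smul]

theorem oneParam_bijective (hlam : ∀ a, 0 < lam a) (z : ℂ) :
    Function.Bijective (D.oneParam lam z) :=
  Function.bijective_iff_has_inverse.2 ⟨D.oneParam lam (-z),
    fun ξ => by rw [← D.oneParam_add hlam, neg_add_cancel, D.oneParam_zero],
    fun ξ => by rw [← D.oneParam_add hlam, add_neg_cancel, D.oneParam_zero]⟩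

theorem tendsto_moduleNorm_oneParam_sub (hlam : ∀ a, 0 < lam a) (ζ : D.Hbim) (z₀ : ℂ) :
    Filter.Tendsto (fun z => moduleNorm D.ip (D.oneParam lam z ζ - D.oneParam lam z₀ ζ))
      (nhds z₀) (nhds 0) := by
  classical
  let w : Triple R → ℂ → ℂ := fun t z => (letterScalar lam t.2.2 : ℂ) ^ (Complex.I * z) -
    (letterScalar lam t.2.2 : ℂ) ^ (Complex.I * z₀)
  have hw : ∀ t, Continuous (w t) := fun t =>
    (differentiable_letterScalar_cpow hlam t.2.2).continuous.sub continuous_const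
  have hU : ∀ z t, (D.oneParam lam z ζ - D.oneParam lam z₀ ζ) t = w t z • ζ t := fun z t => by
    rw [DirectSum.sub_apply, oneParam_apply, oneParam_apply, ← sub_smul]
  have e : (fun z => moduleNorm D.ip (D.oneParam lam z ζ - D.oneParam lam z₀ ζ)) = fun z =>
      Real.sqrt ‖∑ t ∈ DFinsupp.support ζ, (lp.single ∞ t.1
        (star (w t z) * (w t z * D.homInner (ζ t) (ζ t))) : Alg R)‖ := by
    funext z
    rw [moduleNorm, D.ip_eq_sum (s := DFinsupp.support ζ) _ fun t ht => by
      rw [hU, D.eq_zero_of_notMem_support ht, smul_zero]]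
    congr 2
    refine Finset.sum_congr rfl fun t _ => ?_
    rw [hU, homInner_smul_left, homInner_smul_right]
  have hc : Continuous fun z => moduleNorm D.ip (D.oneParam lam z ζ - D.oneParam lam z₀ ζ) := by
    rw [e]
    refine Real.continuous_sqrt.comp (continuous_norm.comp (continuous_finsetSum _ fun t _ => ?_))
    exact (lp.isometry_single t.1).continuous.comp
      ((hw t).star.mul ((hw t).mul continuous_const))
  have h0 : moduleNorm D.ip (D.oneParam lam z₀ ζ - D.oneParam lam z₀ ζ) = 0 := by
    rw [sub_self, moduleNorm, D.ip_eq_sum (s := ∅) _ fun t _ => rfl, Finset.sum_empty, norm_zero,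
      Real.sqrt_zero]
  exact h0 ▸ hc.tendsto z₀

theorem differentiable_scalarInner_oneParam (hlam : ∀ a, 0 < lam a) (hunit : IsSimpleObj (𝟙_ C))
    (ξ ζ : D.Hbim) :
    Differentiable ℂ fun z => scalarInner D.tau D.ip ξ (D.oneParam lam z ζ) := by
  classical
  have e : (fun z => scalarInner D.tau D.ip ξ (D.oneParam lam z ζ)) = fun z =>
      ∑ t ∈ DFinsupp.support ξ, D.dim t.1 * ((letterScalar lam t.2.2 : ℂ) ^ (Complex.I * z) *
        D.homInner (ξ t) (ζ t)) := by
    funext z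
    rw [D.scalarInner_eq_sum hunit _ fun t => D.eq_zero_of_notMem_support]
    refine Finset.sum_congr rfl fun t _ => ?_
    rw [oneParam_apply, homInner_smul_right]
  rw [e]
  exact Differentiable.fun_sum fun t _ =>
    ((differentiable_letterScalar_cpow hlam t.2.2).mul_const _).const_mul _

theorem scalarInner_oneParam (hlam : ∀ a, 0 < lam a) (hunit : IsSimpleObj (𝟙_ C)) (z : ℂ)
    (ξ ζ : D.Hbim) :
    scalarInner D.tau D.ip ξ (D.oneParam lam z ζ) =
      scalarInner D.tau D.ip (D.oneParam lam (-star z) ξ) ζ := by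
  classical
  have h : ∀ t ∉ DFinsupp.support ξ, ξ t = 0 := fun t => D.eq_zero_of_notMem_support
  rw [D.scalarInner_eq_sum hunit _ h,
    D.scalarInner_eq_sum hunit (s := DFinsupp.support ξ) _ fun t ht => by
      rw [oneParam_apply, h t ht, smul_zero]]
  refine Finset.sum_congr rfl fun t _ => ?_
  rw [oneParam_apply, oneParam_apply, homInner_smul_right, homInner_smul_left,
    star_letterScalar_cpow_neg_star hlam]

theorem invol_invol (hlam : ∀ a, 0 < lam a) (ξ : D.Hbim) : D.invol lam (D.invol lam ξ) = ξ := by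
  have key : ∀ t : Triple R, ∀ x : D.HomSpace (Triple.bar (Triple.bar t)),
      ((Real.sqrt (letterScalar lam (Triple.bar t).2.2) : ℝ) : ℂ) •
        ((Real.sqrt (letterScalar lam t.2.2) : ℝ) : ℂ) • x = x := fun t x => by
    have h := letterScalar_pos hlam t.2.2
    rw [smul_smul, ← Complex.ofReal_mul, letterScalar_bar, ← Real.sqrt_mul (inv_pos.2 h).le,
      inv_mul_cancel₀ h.ne', Real.sqrt_one, Complex.ofReal_one, one_smul]
  have key' : ∀ t : Triple R, D.invol lam (D.invol lam ξ) (Triple.bar (Triple.bar t)) =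
      D.homConjHom (Triple.bar t) (D.homConjHom t (ξ t)) := fun t => by
    rw [invol_apply_bar, invol_apply_bar, homConjHom_smul, Complex.star_def,
      Complex.conj_ofReal, key]
  refine DFinsupp.ext ?_
  -- Once the letter is split into cases, the double conjugate of the triple is the triple itself by
  -- definition.
  rintro ⟨b₁, b₂, (a | a)⟩
  · exact (key' (b₁, b₂, Sum.inl a)).trans (D.homConj_homConj_inl b₁ b₂ a _)
  · exact (key' (b₁, b₂, Sum.inr a)).trans (D.homConj_homConj_inr b₁ b₂ a _)

theorem invol_oneParam (hlam : ∀ a, 0 < lam a) (z : ℂ) (ξ : D.Hbim) :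
    D.invol lam (D.oneParam lam z ξ) = D.oneParam lam (star z) (D.invol lam ξ) := by
  refine DFinsupp.ext fun u => ?_
  obtain ⟨t, rfl⟩ := Triple.bar_surjective u
  rw [invol_apply_bar, oneParam_apply, oneParam_apply, invol_apply_bar, homConjHom_smul,
    star_letterScalar_cpow hlam, smul_comm]

theorem invol_smul (c : ℂ) (ξ : D.Hbim) : D.invol lam (c • ξ) = star c • D.invol lam ξ := by
  refine DFinsupp.ext fun u => ?_
  obtain ⟨t, rfl⟩ := Triple.bar_surjective u
  rw [invol_apply_bar, DirectSum.smul_apply, DirectSum.smul_apply, invol_apply_bar,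
    homConjHom_smul, smul_comm]

theorem invol_action (a b : Alg R) (ξ : D.Hbim) :
    D.invol lam (a • (MulOpposite.op b • ξ)) =
      star b • (MulOpposite.op (star a) • D.invol lam ξ) := by
  refine DFinsupp.ext fun u => ?_
  obtain ⟨t, rfl⟩ := Triple.bar_surjective u
  rw [invol_apply_bar, left_smul_apply, left_smul_apply, right_smul_apply, right_smul_apply,
    invol_apply_bar, homConjHom_smul, homConjHom_smul, lp.star_apply, lp.star_apply, smul_comm,
    smul_comm _ (star (b t.1)), smul_comm (star (a t.2.1)) (star (b t.1))]

theorem scalarInner_invol (hlam : ∀ a, 0 < lam a) (hunit : IsSimpleObj (𝟙_ C)) (ξ ζ : D.Hbim) :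
    scalarInner D.tau D.ip (D.invol lam ξ) (D.invol lam ζ) =
      scalarInner D.tau D.ip ζ (D.oneParam lam (-Complex.I) ξ) := by
  classical
  let s := DFinsupp.support ξ ∪ DFinsupp.support ζ
  have hξ : ∀ t ∉ s, ξ t = 0 := fun t ht =>
    D.eq_zero_of_notMem_support fun h => ht (Finset.mem_union_left _ h)
  have hζ : ∀ t ∉ s, ζ t = 0 := fun t ht =>
    D.eq_zero_of_notMem_support fun h => ht (Finset.mem_union_right _ h)
  have hS : ∀ u ∉ s.image Triple.bar, D.invol lam ξ u = 0 := fun u hu => by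
    obtain ⟨t, rfl⟩ := Triple.bar_surjective u
    rw [invol_apply_bar, hξ t fun h => hu (Finset.mem_image_of_mem _ h), map_zero, smul_zero]
  rw [D.scalarInner_eq_sum hunit _ hS, D.scalarInner_eq_sum hunit _ hζ,
    Finset.sum_image fun _ _ _ _ h => Triple.bar_injective h]
  refine Finset.sum_congr rfl fun t _ => ?_
  have h := letterScalar_pos hlam t.2.2
  -- On the left S contributes √λ_α twice; on the right U(-i) contributes λ_α^{i(-i)} = λ_α. After
  -- cancellation the trace identity for ξ̄ and ζ̄ remains.
  rw [invol_apply_bar, invol_apply_bar, oneParam_apply, homInner_smul_left, homInner_smul_right,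
    homInner_smul_right, mul_neg, Complex.I_mul_I, neg_neg, Complex.cpow_one, Complex.star_def,
    Complex.conj_ofReal, ← mul_assoc ((Real.sqrt _ : ℝ) : ℂ), ← Complex.ofReal_mul,
    Real.mul_self_sqrt h.le, mul_left_comm, mul_left_comm _ (letterScalar lam t.2.2 : ℂ)]
  congr 1
  exact D.dim_mul_homInner_homConjHom hunit _ _

end OneParam

end StandardConjugates
end TomitaFromCategory

end

theorem mainTheorem12 {C : Type u} [Category.{v} C] [Preadditive C] [Linear ℂ C]
    [MonoidalCategory C] [MonoidalPreadditive C] [MonoidalLinear ℂ C]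
    [RigidCStarTensorCategory C]
    (hunit : TomitaFromCategory.IsSimpleObj (𝟙_ C))
    (R : TomitaFromCategory.Representatives C)
    (D : TomitaFromCategory.StandardConjugates R)
    (lam : R.Idx → ℝ) (hlam : ∀ a, 0 < lam a) :
    TomitaBimodule.IsTomitaBimodule (A := TomitaFromCategory.Alg R) (H := D.Hbim)
      D.tau D.ip (D.invol lam) (fun z => D.oneParam lam z) where
  vonNeumann := inferInstance
  trace := D.isNSFTrace_tau hunit
  preHilbert := D.isPreHilbertBimodule
  normal := D.hasNormalLeftAction
  finite := D.tau_ip_self_lt_top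
  S_add := map_add _
  S_smul := D.invol_smul
  S_action := D.invol_action
  S_S := D.invol_invol hlam
  U_add z := map_add _
  U_smul z := map_smul _
  U_action z a b ξ := DFinsupp.ext fun t => by
    rw [D.oneParam_apply, D.left_smul_apply, D.left_smul_apply, D.right_smul_apply,
      D.right_smul_apply, D.oneParam_apply, smul_comm, smul_comm _ (b t.1)]
  U_bijective := D.oneParam_bijective hlam
  U_zero := D.oneParam_zero
  U_group := D.oneParam_add hlam
  U_continuous := D.tendsto_moduleNorm_oneParam_sub hlam
  U_entire := D.differentiable_scalarInner_oneParam hlam hunit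
  S_U := D.invol_oneParam hlam
  U_adjoint := D.scalarInner_oneParam hlam hunit
  S_inner := D.scalarInner_invol hlam hunit
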